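/- Let $\mathcal C=\langle S,s_I,\Delta,E,C,L\rangle$ be a labeled continuous-time Markov chain with finite state set $S$, initial state $s_I$, transition matrix $\Delta\colon S\to\mathrm{Distr}(S)$, exit rates $E\colon S\to\mathbb R_{\ge 0}$ and labeling $L\colon S\to C$. A timed path $\pi=s_0\tau_0s_1\tau_1\cdots$ starts in $s_0=s_I$, jumps from $s_n$ to $s_{n+1}$ with probability $\Delta(s_n)(s_{n+1})$, and stays in $s_n$ for an exponentially distributed time $\tau_n$ with rate $E(s_n)$ ($\tau_n=\infty$ if $E(s_n)=0$); $\mathbb P_{\mathcal C}$ is the resulting measure on paths and $\pi(t)$ is the state occupied at time $t$. Let $R(s,s')=\Delta(s)(s')E(s)$ and let $\mathrm{Pr}_s(t)=\delta_s\, e^{(R-\mathrm{diag}(E))t}$ be the transient distribution. Let $w\colon S\to\mathbb R_{\ge0}$ be a state-weight function. Evidence of length $d\ge 1$ is a sequence $\rho=\langle t_1,o_1\rangle,\dots,\langle t_d,o_d\rangle$ with $0<t_1<\dots<t_d$ and $o_i\in C$; write $\pi\models\rho$ if $L(\pi(t_i))=o_i$ for all $i$. Imprecise evidence $\Omega=\langle\mathcal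 T_1,o_1\rangle,\dots,\langle\mathcal T_d,o_d\rangle$ consists of labels $o_i\in C$ and sets $\mathcal T_i\subset\mathbb R_{>0}$, each a finite nonempty union of nonempty compact intervals, with $\max\mathcal T_i<\min\mathcal T_{i+1}$. An instance $\rho\in\Omega$ is evidence with the same labels and with $t_i\in\mathcal T_i$ for all $i$. With the convention that a conditional probability given an event of probability $0$ is $0$, put $$W(\Omega)=\sup_{\rho\in\Omega}\sum_{s\in S}\mathbb P_{\mathcal C}\big(\pi(t_d)=s\mid\pi\models\rho\big)\,w(s).$$ The evidence graph $\mathcal G_\rho$ of $\rho$ has nodes $0,t_1,\dots,t_d,t_\star$, where $t_\star$ is a fresh terminal node later than all times, and edges $0\to t_1\to\dots\to t_d\to t_\star$; let $\mathcal G_\Omega=\bigcup_{\rho\in\Omega}\mathcal G_\rho$, with node set $\mathcal N$. The unfolded MDP $\mathcal M$ has states $S\times\mathcal N$, initial state $\langle s_I,0\rangle$ and actions $\mathcal N$; in $\langle s,t\rangle$ the graph successors $t'$ of $t$ are enabled, and action $t'$ leads to $\langle s',t'\rangle$ with probability $\mathrm{Pr}_s(t'-t)(s')$ if $t'\ne t_\star$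 and $\mathbb 1_{(s=s')}$ if $t'=t_\star$; the states $\langle s,t_\star\rangle$ are absorbing. A scheduler $\sigma$ maps each non-terminal state to an enabled action, and $\mathbb P^\sigma_{\mathcal M}$ is the induced measure on MDP paths $\xi$. It is consistent with $\rho\in\Omega$, written $\sigma\sim\rho$, if for all $s\in S$: $\sigma(\langle s,0\rangle)=t_1$, $\sigma(\langle s,t_i\rangle)=t_{i+1}$ for $1\le i<d$, and $\sigma(\langle s,t_d\rangle)=t_\star$. Write $\xi\models\rho$ if for every $i$ the path $\xi$ visits a state $\langle s,t_i\rangle$ with $L(s)=o_i$, and $\lozenge\langle s,t_\star\rangle$ for the event that $\xi$ visits $\langle s,t_\star\rangle$. Theorem. For every $\rho\in\Omega$, every scheduler $\sigma\sim\rho$ and every $s\in S$, $$\mathbb P_{\mathcal C}\big(\pi(t_d)=s\mid\pi\models\rho\big)=\mathbb P^\sigma_{\mathcal M}\big(\lozenge\langle s,t_\star\rangle\mid\xi\models\rho\big),$$ and $$W(\Omega)=\sup_{\rho\in\Omega,\ \sigma\sim\rho}\ \sum_{s\in S}\mathbb P^\sigma_{\mathcal M}\big(\lozenge\langle s,t_\star\rangle\mid\xi\models\rho\big)\,w(s).$$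 -/

import Mathlib

open MeasureTheory ProbabilityTheory
open scoped NNReal ENNReal

noncomputable section

/-! ### Labeled continuous-time Markov chains -/

/-- A labeled CTMC with states `S` and colors `C`. The transition matrix maps a state to a
probability distribution on states; the exit rates are nonnegative. -/
structure CTMC (S C : Type*) where
  init : S
  trans : S → PMF S
  rate : S → ℝ≥0
  label : S → C

namespace CTMC

variable {S C : Type*}

lemma sum_trans_toReal [Fintype S] (M : CTMC S C) (s : S) : ∑ s', (M.trans s s').toReal = 1 := by
  rw [← ENNReal.toReal_sum (fun s' _ => (M.trans s).apply_ne_top s'),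
    ← tsum_fintype (L := .unconditional S), (M.trans s).tsum_coe, ENNReal.toReal_one]

section Transient

variable [DecidableEq S]

/-- The generator `R - diag E`, where `R s s' = Δ s s' * E s`. -/
def generator (M : CTMC S C) : Matrix S S ℝ :=
  Matrix.of (fun s s' => (M.trans s s').toReal * (M.rate s : ℝ))
    - Matrix.diagonal (fun s => (M.rate s : ℝ))

variable [Fintype S]

/-- `Pr_s(t)(s')`, the entry `(s, s')` of the matrix exponential `exp ((R - diag E) t)`. -/
def transientProb (M : CTMC S C) (s : S) (t : ℝ≥0) (s' : S) : ℝ :=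
  NormedSpace.exp ((t : ℝ) • M.generator) s s'

lemma generator_mulVec_one (M : CTMC S C) : M.generator.mulVec 1 = 0 := by
  ext s
  simp [generator, Matrix.mulVec, dotProduct, Matrix.diagonal_apply,
    ← Finset.sum_mul, M.sum_trans_toReal s]

open scoped Matrix.Norms.Operator in
lemma hasSum_exp_apply (A : Matrix S S ℝ) (s s' : S) :
    HasSum (fun n : ℕ => ((n.factorial : ℝ)⁻¹ • A ^ n) s s') (NormedSpace.exp A s s') := by
  have h := NormedSpace.exp_series_hasSum_exp' (𝕂 := ℝ) A
  exact h.map ((Matrix.entryAddMonoidHom ℝ s s')) (by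
    exact (continuous_apply s').comp (continuous_apply s))

lemma exp_apply_nonneg (A : Matrix S S ℝ) (hA : ∀ s s', 0 ≤ A s s') (s s' : S) :
    0 ≤ NormedSpace.exp A s s' := by
  have hpow : ∀ (n : ℕ) (s s' : S), 0 ≤ (A ^ n) s s' := by
    intro n
    induction n with
    | zero => intro s s'; by_cases h : s = s' <;> simp [h]
    | succ n ih =>
      intro s s'
      rw [pow_succ, Matrix.mul_apply]
      exact Finset.sum_nonneg fun k _ => mul_nonneg (ih s k) (hA k s')
  refine (hasSum_exp_apply A s s').nonneg fun n => ?_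
  rw [Matrix.smul_apply, smul_eq_mul]
  exact mul_nonneg (by positivity) (hpow n s s')

open scoped Matrix.Norms.Operator in
lemma transientProb_nonneg (M : CTMC S C) (s : S) (t : ℝ≥0) (s' : S) :
    0 ≤ M.transientProb s t s' := by
  set b : ℝ := ∑ k, (M.rate k : ℝ) with hb
  set B : Matrix S S ℝ := M.generator + b • (1 : Matrix S S ℝ) with hB
  have hBnn : ∀ k k', 0 ≤ B k k' := by
    intro k k'
    have hk : (M.rate k : ℝ) ≤ b :=
      Finset.single_le_sum (f := fun k => (M.rate k : ℝ)) (fun _ _ => NNReal.coe_nonneg _)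
        (Finset.mem_univ k)
    have h0 : 0 ≤ (M.trans k k').toReal * (M.rate k : ℝ) := by positivity
    by_cases h : k = k'
    · subst h
      simp only [hB, generator, Matrix.add_apply, Matrix.sub_apply, Matrix.of_apply,
        Matrix.diagonal_apply_eq, Matrix.smul_apply, Matrix.one_apply_eq, smul_eq_mul]
      linarith
    · simp [hB, generator, Matrix.diagonal_apply_ne _ h, Matrix.one_apply_ne h]
      positivity
  have hsplit : (t : ℝ) • M.generator = (t : ℝ) • B + (-(t * b)) • (1 : Matrix S S ℝ) := by
    rw [hB]; module
  have hexp : NormedSpace.exp ((t : ℝ) • M.generator)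
      = Real.exp (-(t * b)) • NormedSpace.exp ((t : ℝ) • B) := by
    rw [hsplit, Matrix.exp_add_of_commute _ _ ((Commute.one_right _).smul_right _)]
    have h1 : (-(t * b)) • (1 : Matrix S S ℝ) = Matrix.diagonal (fun _ => -(t * b)) := by
      rw [← Matrix.diagonal_one, ← Matrix.diagonal_smul]
      congr 1
      ext
      simp
    have h2 : NormedSpace.exp (fun _ : S => -(t * b)) = fun _ : S => Real.exp (-(t * b)) := by
      ext k
      rw [Pi.coe_exp, Real.exp_eq_exp_ℝ]
    rw [h1, Matrix.exp_diagonal, h2, ← Matrix.smul_one_eq_diagonal, mul_smul_comm, mul_one]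
  rw [transientProb, hexp, Matrix.smul_apply, smul_eq_mul]
  refine mul_nonneg (Real.exp_nonneg _) (exp_apply_nonneg _ (fun k k' => ?_) s s')
  rw [Matrix.smul_apply, smul_eq_mul]
  exact mul_nonneg t.coe_nonneg (hBnn k k')

lemma sum_transientProb (M : CTMC S C) (s : S) (t : ℝ≥0) :
    ∑ s', M.transientProb s t s' = 1 := by
  have h := hasSum_sum (s := Finset.univ)
    (fun s' _ => hasSum_exp_apply ((t : ℝ) • M.generator) s s')
  have hz : ∀ n : ℕ, n ≠ 0 →
      ∑ s', ((n.factorial : ℝ)⁻¹ • ((t : ℝ) • M.generator) ^ n) s s' = 0 := by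
    intro n hn
    obtain ⟨m, rfl⟩ := Nat.exists_eq_succ_of_ne_zero hn
    have hv : (((t : ℝ) • M.generator) ^ (m + 1)).mulVec 1 = 0 := by
      rw [pow_succ, ← Matrix.mulVec_mulVec, Matrix.smul_mulVec, generator_mulVec_one,
        smul_zero, Matrix.mulVec_zero]
    have hs := congrFun hv s
    simp only [Matrix.mulVec, dotProduct, Pi.one_apply, mul_one, Pi.zero_apply] at hs
    simp only [Matrix.smul_apply, ← Finset.smul_sum]
    rw [Nat.succ_eq_add_one, hs, smul_zero]
  have h1 := h.unique (hasSum_single 0 hz)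
  simpa [transientProb, Matrix.one_apply] using h1

/-- The transient probability distribution `Pr_s(t)`. -/
def transient (M : CTMC S C) (s : S) (t : ℝ≥0) : PMF S :=
  PMF.ofFintype (fun s' => ENNReal.ofReal (M.transientProb s t s')) (by
    rw [← ENNReal.ofReal_sum_of_nonneg (fun s' _ => M.transientProb_nonneg s t s'),
      M.sum_transientProb, ENNReal.ofReal_one])

end Transient

section Paths

/-- A timed path `s₀ τ₀ s₁ τ₁ ⋯`: entry `n` is the `n`-th state together with the time spent
in it. The residence time is infinite in a state that is never left. -/
abbrev Path (S : Type*) := ℕ → S × ℝ≥0∞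

/-- The state `π(t)` occupied at time `t`: the state `sₙ` for the first `n` with
`t < τ₀ + ⋯ + τₙ`. (Paths without such an `n` form a null set; they get the value `s₀`.) -/
def Path.stateAt (π : Path S) (t : ℝ≥0) : S :=
  open Classical in
  if h : ∃ n, (t : ℝ≥0∞) < ∑ k ∈ Finset.range (n + 1), (π k).2
  then (π (Nat.find h)).1 else (π 0).1

/-- The distribution of the residence time in `s`: exponential with rate `E s`, and infinite if
`E s = 0`. -/
def residence (M : CTMC S C) (s : S) : Measure ℝ≥0∞ :=
  if M.rate s = 0 then Measure.dirac ∞ else (expMeasure (M.rate s : ℝ)).map ENNReal.ofReal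

instance (M : CTMC S C) (s : S) : IsProbabilityMeasure (M.residence s) := by
  unfold residence
  split_ifs with h
  · infer_instance
  · have : IsProbabilityMeasure (expMeasure (M.rate s : ℝ)) :=
      isProbabilityMeasure_expMeasure (by positivity)
    exact Measure.isProbabilityMeasure_map ENNReal.measurable_ofReal.aemeasurable

variable [MeasurableSpace S] [DiscreteMeasurableSpace S]

/-- Residence times as a kernel. -/
def residenceKernel (M : CTMC S C) : Kernel S ℝ≥0∞ := ⟨M.residence, .of_discrete⟩

instance (M : CTMC S C) : IsMarkovKernel M.residenceKernel :=
  ⟨fun s => inferInstanceAs (IsProbabilityMeasure (M.residence s))⟩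

/-- One jump: the successor of `s` is drawn from `Δ s`, then its residence time. -/
def jumpKernel (M : CTMC S C) : Kernel S (S × ℝ≥0∞) :=
  ⟨fun s => (M.trans s).toMeasure ⊗ₘ M.residenceKernel, .of_discrete⟩

instance (M : CTMC S C) : IsMarkovKernel M.jumpKernel :=
  ⟨fun s => inferInstanceAs
    (IsProbabilityMeasure ((M.trans s).toMeasure ⊗ₘ M.residenceKernel))⟩

/-- The next entry of a path given the first `n + 1` entries; it depends on the current state. -/
def stepKernel (M : CTMC S C) (n : ℕ) :
    Kernel ((i : Finset.Iic n) → (fun _ : ℕ => S × ℝ≥0∞) i) (S × ℝ≥0∞) :=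
  M.jumpKernel.comap (fun x => (x ⟨n, Finset.mem_Iic.2 le_rfl⟩).1) (by fun_prop)

instance (M : CTMC S C) (n : ℕ) : IsMarkovKernel (M.stepKernel n) := by
  unfold stepKernel; infer_instance

/-- The probability measure `ℙ_C` on timed paths started in the initial state. -/
def pathMeasure (M : CTMC S C) : Measure (Path S) :=
  Kernel.trajMeasure (X := fun _ => S × ℝ≥0∞)
    (Measure.dirac M.init ⊗ₘ M.residenceKernel) M.stepKernel

end Paths

end CTMC

/-! ### Precise and imprecise evidence -/

/-- Precisely timed evidence of length `d`: positive, strictly increasing times, each with a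
label. -/
structure Evidence (C : Type*) (d : ℕ) where
  time : Fin d → ℝ≥0
  label : Fin d → C
  time_pos : ∀ i, 0 < time i
  time_lt : ∀ i j : Fin d, (i : ℕ) + 1 = j → time i < time j

/-- Imprecisely timed evidence of length `d`: label `i` is observed at some time in `times i`, a
finite nonempty union of nonempty compact intervals of positive times; all times in `times i`
precede all times in `times (i + 1)`. -/
structure ImpreciseEvidence (C : Type*) (d : ℕ) where
  times : Fin d → Set ℝ≥0
  label : Fin d → C
  exists_intervals : ∀ i, ∃ (q : ℕ) (lo hi : Fin q → ℝ≥0), 0 < q ∧ (∀ j, lo j ≤ hi j) ∧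
    times i = ⋃ j, Set.Icc (lo j) (hi j)
  times_pos : ∀ i, ∀ t ∈ times i, 0 < t
  times_lt : ∀ i j : Fin d, (i : ℕ) + 1 = j → ∀ t ∈ times i, ∀ t' ∈ times j, t < t'

/-- `ρ ∈ Ω`: the evidence `ρ` is an instance of the imprecise evidence `Ω`. -/
instance {C : Type*} {d : ℕ} : Membership (Evidence C d) (ImpreciseEvidence C d) where
  mem Ω ρ := (∀ i, ρ.time i ∈ Ω.times i) ∧ ∀ i, ρ.label i = Ω.label i

lemma ImpreciseEvidence.exists_mem {C : Type*} {d : ℕ} (Ω : ImpreciseEvidence C d) :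
    ∃ ρ : Evidence C d, ρ ∈ Ω := by
  have h : ∀ i, ∃ t, t ∈ Ω.times i := by
    intro i
    obtain ⟨q, lo, hi, hq, hle, heq⟩ := Ω.exists_intervals i
    rw [heq]
    exact ⟨lo ⟨0, hq⟩, Set.mem_iUnion.2 ⟨⟨0, hq⟩, le_rfl, hle _⟩⟩
  choose t ht using h
  exact ⟨⟨t, Ω.label, fun i => Ω.times_pos i _ (ht i),
    fun i j hij => Ω.times_lt i j hij _ (ht i) _ (ht j)⟩, ht, fun _ => rfl⟩

namespace Evidence

variable {C : Type*} {d : ℕ} [NeZero d]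

/-- The index of the first observation. -/
abbrev firstIdx (d : ℕ) [NeZero d] : Fin d := ⟨0, NeZero.pos d⟩

/-- The index of the last observation. -/
abbrev lastIdx (d : ℕ) [NeZero d] : Fin d := ⟨d - 1, Nat.sub_lt (NeZero.pos d) Nat.one_pos⟩

/-- The time `t_d` of the last observation. -/
def lastTime (ρ : Evidence C d) : ℝ≥0 := ρ.time (lastIdx d)

end Evidence

/-- `π ⊨ ρ` for timed CTMC paths: the label of `π` at each evidence time is the observed one. -/
def CTMC.Path.Satisfies {S C : Type*} {d : ℕ} (M : CTMC S C) (π : CTMC.Path S)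
    (ρ : Evidence C d) : Prop :=
  ∀ i, M.label (π.stateAt (ρ.time i)) = ρ.label i

/-- The conditional probability `ℙ_C(π(t_d) = s ∣ π ⊨ ρ)`, which is `0` if the condition has
probability `0`. -/
def CTMC.condTransient {S C : Type*} [MeasurableSpace S] [DiscreteMeasurableSpace S]
    {d : ℕ} [NeZero d] (M : CTMC S C) (ρ : Evidence C d) (s : S) : ℝ≥0∞ :=
  M.pathMeasure[{π | π.stateAt ρ.lastTime = s} | {π | π.Satisfies M ρ}]

/-- The maximal weighted conditional reachability probability `W(Ω)`. -/
def CTMC.weightedReach {S C : Type*} [Fintype S] [MeasurableSpace S] [DiscreteMeasurableSpace S]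
    {d : ℕ} [NeZero d] (M : CTMC S C) (w : S → ℝ≥0) (Ω : ImpreciseEvidence C d) : ℝ≥0∞ :=
  ⨆ ρ : Evidence C d, ⨆ _ : ρ ∈ Ω, ∑ s, M.condTransient ρ s * w s

/-! ### Evidence graphs -/

/-- Time points of an evidence graph: `⊤` is the terminal node `t⋆`, later than every time. -/
abbrev TimePoint := WithTop ℝ≥0

/-- A graph on time points that contains time `0` and whose edges go forward in time. -/
structure EvidenceGraph where
  nodes : Set TimePoint
  Edge : TimePoint → TimePoint → Prop
  zero_mem : 0 ∈ nodes
  edge_mem : ∀ t t', Edge t t' → t ∈ nodes ∧ t' ∈ nodes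
  edge_lt : ∀ t t', Edge t t' → t < t'

namespace Evidence

variable {C : Type*} {d : ℕ} [NeZero d]

/-- The nodes `0, t₁, …, t_d, t⋆` of the graph of `ρ`. -/
def nodes (ρ : Evidence C d) : Set TimePoint :=
  {0} ∪ Set.range (fun i => (ρ.time i : TimePoint)) ∪ {⊤}

/-- The edges `0 → t₁`, `tᵢ → tᵢ₊₁` and `t_d → t⋆` of the graph of `ρ`. -/
def Edge (ρ : Evidence C d) (t t' : TimePoint) : Prop :=
  (t = 0 ∧ t' = (ρ.time (firstIdx d) : TimePoint)) ∨
  (∃ i j : Fin d, (i : ℕ) + 1 = j ∧ t = (ρ.time i : TimePoint) ∧ t' = (ρ.time j : TimePoint)) ∨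
  (t = (ρ.lastTime : TimePoint) ∧ t' = ⊤)

/-- The evidence graph of the precise evidence `ρ`. -/
def graph (ρ : Evidence C d) : EvidenceGraph where
  nodes := ρ.nodes
  Edge := ρ.Edge
  zero_mem := by simp [nodes]
  edge_mem := by
    have h : ∀ i, (ρ.time i : TimePoint) ∈ ρ.nodes := fun i => Or.inl (Or.inr ⟨i, rfl⟩)
    rintro t t' (⟨rfl, rfl⟩ | ⟨i, j, -, rfl, rfl⟩ | ⟨rfl, rfl⟩)
    · exact ⟨Or.inl (Or.inl rfl), h _⟩
    · exact ⟨h i, h j⟩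
    · exact ⟨h _, Or.inr rfl⟩
  edge_lt := by
    rintro t t' (⟨rfl, rfl⟩ | ⟨i, j, hij, rfl, rfl⟩ | ⟨rfl, rfl⟩)
    · exact_mod_cast ρ.time_pos _
    · exact_mod_cast ρ.time_lt i j hij
    · exact WithTop.coe_lt_top _

end Evidence

/-- The evidence graph of `Ω`: the union of the graphs of all its instances. -/
def ImpreciseEvidence.graph {C : Type*} {d : ℕ} [NeZero d] (Ω : ImpreciseEvidence C d) :
    EvidenceGraph where
  nodes := {t | ∃ ρ : Evidence C d, ρ ∈ Ω ∧ t ∈ ρ.graph.nodes}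
  Edge t t' := ∃ ρ : Evidence C d, ρ ∈ Ω ∧ ρ.graph.Edge t t'
  zero_mem := Ω.exists_mem.imp fun ρ h => ⟨h, ρ.graph.zero_mem⟩
  edge_mem := fun t t' ⟨ρ, h, he⟩ =>
    ⟨⟨ρ, h, (ρ.graph.edge_mem t t' he).1⟩, ⟨ρ, h, (ρ.graph.edge_mem t t' he).2⟩⟩
  edge_lt := fun t t' ⟨ρ, _, he⟩ => ρ.graph.edge_lt t t' he

/-! ### Markov decision processes -/

/-- An MDP with states `Q` and actions `A`: every enabled action of a state yields a distribution
over successor states. -/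
structure MDP (Q A : Type*) where
  init : Q
  enabled : Q → Set A
  trans : (q : Q) → enabled q → PMF Q

namespace MDP

variable {Q A : Type*}

/-- Memoryless deterministic schedulers. They choose enabled actions; in a terminal state, which
has none, the value is irrelevant. -/
structure Scheduler (M : MDP Q A) where
  act : Q → A
  act_mem : ∀ q, (M.enabled q).Nonempty → act q ∈ M.enabled q

/-- The successor distribution in the Markov chain induced by `σ`. Terminal states are
absorbing. -/
def inducedStep (M : MDP Q A) (σ : M.Scheduler) (q : Q) : PMF Q :=
  open Classical in
  if h : (M.enabled q).Nonempty then M.trans q ⟨σ.act q, σ.act_mem q h⟩ else PMF.pure q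

variable [MeasurableSpace Q] [DiscreteMeasurableSpace Q]

/-- The induced Markov chain as a sequence of kernels. -/
def stepKernel (M : MDP Q A) (σ : M.Scheduler) (n : ℕ) :
    Kernel ((i : Finset.Iic n) → (fun _ : ℕ => Q) i) Q :=
  (⟨fun q => (M.inducedStep σ q).toMeasure, .of_discrete⟩ : Kernel Q Q).comap
    (fun x => x ⟨n, Finset.mem_Iic.2 le_rfl⟩) (by fun_prop)

instance (M : MDP Q A) (σ : M.Scheduler) (n : ℕ) : IsMarkovKernel (M.stepKernel σ n) :=
  ⟨fun x => inferInstanceAs (IsProbabilityMeasure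
    (M.inducedStep σ (x ⟨n, Finset.mem_Iic.2 le_rfl⟩)).toMeasure)⟩

/-- The probability measure `ℙ_M^σ` on infinite paths from the initial state. -/
def pathMeasure (M : MDP Q A) (σ : M.Scheduler) : Measure (ℕ → Q) :=
  Kernel.trajMeasure (X := fun _ => Q) (Measure.dirac M.init) (M.stepKernel σ)

end MDP

/-! ### The unfolded MDP -/

/-- States `⟨s, t⟩` of the unfolding of a CTMC over the graph `G`. -/
structure UnfoldState (S : Type*) (G : EvidenceGraph) where
  state : S
  time : G.nodes

instance {S : Type*} {G : EvidenceGraph} : MeasurableSpace (UnfoldState S G) := ⊤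

instance {S : Type*} {G : EvidenceGraph} : DiscreteMeasurableSpace (UnfoldState S G) :=
  ⟨fun _ => trivial⟩

/-- The distribution of the next CTMC state when moving from state `s` at time `t` to time `t'`:
`Pr_s(t' - t)` if `t' ≠ t⋆`, and `s` itself if `t' = t⋆`. (The last case never arises, as
there is no edge that starts in `t⋆`.) -/
def CTMC.unfoldStep {S C : Type*} [Fintype S] [DecidableEq S] (M : CTMC S C) (s : S) :
    TimePoint → TimePoint → PMF S
  | _, none => PMF.pure s
  | some t, some t' => M.transient s (t' - t)
  | none, some _ => PMF.pure s

/-- The unfolded MDP `Unfold(C, G)`: in `⟨s, t⟩` the successor nodes `t'` of `t` are enabled, and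
`P(⟨s, t⟩, t', ⟨s', t'⟩)` is `Pr_s(t' - t)(s')`, or `1` if `s = s'` and else `0` when
`t' = t⋆`. -/
def CTMC.unfold {S C : Type*} [Fintype S] [DecidableEq S] (M : CTMC S C) (G : EvidenceGraph) :
    MDP (UnfoldState S G) G.nodes where
  init := ⟨M.init, ⟨0, G.zero_mem⟩⟩
  enabled q := {t' | G.Edge q.time t'}
  trans q t' := (M.unfoldStep q.state q.time t'.1).map fun s' => ⟨s', t'.1⟩

section Unfolding

variable {S C : Type*} [Fintype S] [DecidableEq S] {d : ℕ} [NeZero d] {M : CTMC S C}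
  {G : EvidenceGraph}

/-- `σ ∼ ρ`: in every CTMC state the scheduler chooses `t₁` at time `0`, `tᵢ₊₁` at time `tᵢ`, and
`t⋆` at time `t_d`. -/
def MDP.Scheduler.Consistent (σ : (M.unfold G).Scheduler) (ρ : Evidence C d) : Prop :=
  ∀ q : UnfoldState S G,
    ((q.time : TimePoint) = 0 → (σ.act q : TimePoint) = ρ.time (Evidence.firstIdx d)) ∧
    (∀ i j : Fin d, (i : ℕ) + 1 = j → (q.time : TimePoint) = ρ.time i →
      (σ.act q : TimePoint) = ρ.time j) ∧
    ((q.time : TimePoint) = ρ.lastTime → (σ.act q : TimePoint) = ⊤)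

end Unfolding

/-- `ξ ⊨ ρ` for paths of the unfolded MDP: at each evidence time, the path is in a state with the
observed label. -/
def UnfoldState.PathSatisfies {S C : Type*} {G : EvidenceGraph} {d : ℕ} (M : CTMC S C)
    (ξ : ℕ → UnfoldState S G) (ρ : Evidence C d) : Prop :=
  ∀ i, ∃ n, ((ξ n).time : TimePoint) = ρ.time i ∧ M.label (ξ n).state = ρ.label i

/-- The event `◇⟨s, t⋆⟩`: the path eventually reaches the terminal state `⟨s, t⋆⟩`. -/
def UnfoldState.Reaches {S : Type*} {G : EvidenceGraph} (ξ : ℕ → UnfoldState S G) (s : S) : Prop :=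
  ∃ n, (ξ n).state = s ∧ ((ξ n).time : TimePoint) = ⊤

/-- The conditional reachability probability `ℙ_M^σ(◇⟨s, t⋆⟩ ∣ ξ ⊨ ρ)` in the unfolding of `M`,
which is `0` if the condition has probability `0`. -/
def CTMC.condReach {S C : Type*} [Fintype S] [DecidableEq S] {d : ℕ} (M : CTMC S C)
    {G : EvidenceGraph} (σ : (M.unfold G).Scheduler) (ρ : Evidence C d) (s : S) : ℝ≥0∞ :=
  ((M.unfold G).pathMeasure σ)[{ξ | UnfoldState.Reaches ξ s} |
    {ξ | UnfoldState.PathSatisfies M ξ ρ}]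

end

/-!
Both conditional probabilities equal the same quotient of two sums over state sequences
`s₁, …, s_d` of products `∏ Pr_{sᵢ₋₁}(tᵢ - tᵢ₋₁)(sᵢ)`, computed by `CTMC.visitProb`: the numerator
and the denominator run over the sequences compatible with the observations, with `s_d = s` in the
numerator. Hence the two suprema range over the same values, as soon as every instance of `Ω` has a
consistent scheduler (`CTMC.exists_consistent`).

For the CTMC the formula says that the finite-dimensional distributions of the jump process are
given by the matrix exponential of the generator `Q`. This rests on the Markov property at a
deterministic time, `CTMC.pathFrom_occupiesAt_and`. Let `f_s(t)` be the probability that a path from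
`s` is in `A` at time `t` and in `Bᵢ` at the times `t + uᵢ`, and `b_s` the same probability for
`t = 0`. Conditioning on the first jump (`CTMC.lintegral_pathFrom`), and using that exponential
residence times are memoryless (`CTMC.lintegral_residence_split`), gives the renewal equation
`f_s(t) = exp(-E(s) t) b_s + ∫₀ᵗ E(s) exp(-E(s) x) ∑_{s'} Δ(s)(s') f_{s'}(t - x) dx`.
Its only bounded measurable solution is `f(t) = exp(t Q) b` (`CTMC.eq_exp_mulVec_of_renewal`). The
event "in `A` at time `t`" is taken to include that the path does not explode before `t`
(`CTMC.Path.OccupiesAt`), for only then the equation holds path by path; the case where `A` is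
everything shows afterwards that explosion before `t` has probability `0`, because the rows of
`exp(t Q)` sum to `1`.

For the unfolding, a consistent scheduler induces a Markov chain that almost surely runs through the
nodes `0, t₁, …, t_d, t⋆, t⋆, …` in order (`CTMC.ae_path_node`), so that its events are events about
the states at the steps `1, …, d`. Their probabilities follow from the first-step decomposition of
homogeneous Markov chains (`MarkovChain.chainKernel_eq_map_consPath`), on which the analysis of the
first jump of the CTMC rests too.
-/

noncomputable section

/-! ### Homogeneous Markov chains and their first-step decomposition -/

namespace MarkovChain

variable {X : Type*} [MeasurableSpace X]

/-- A one-step kernel `κ`, seen as a transition rule that reads the whole history but depends on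
its last entry only. -/
def lastStep (κ : Kernel X X) (n : ℕ) : Kernel ((i : Finset.Iic n) → (fun _ : ℕ => X) i) X :=
  κ.comap (fun x => x ⟨n, Finset.mem_Iic.2 le_rfl⟩) (by fun_prop)

instance (κ : Kernel X X) [IsMarkovKernel κ] (n : ℕ) : IsMarkovKernel (lastStep κ n) := by
  unfold lastStep; infer_instance

/-- The law of the Markov chain with transition kernel `κ`, as a function of its initial state. -/
def chainKernel (κ : Kernel X X) [IsMarkovKernel κ] : Kernel X (ℕ → X) :=
  (Kernel.traj (X := fun _ => X) (lastStep κ) 0).comap (fun x _ => x) (by fun_prop)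

instance (κ : Kernel X X) [IsMarkovKernel κ] : IsMarkovKernel (chainKernel κ) := by
  unfold chainKernel; infer_instance

lemma trajMeasure_lastStep (κ : Kernel X X) [IsMarkovKernel κ] (μ : Measure X) :
    Kernel.trajMeasure (X := fun _ => X) μ (lastStep κ) = chainKernel κ ∘ₘ μ := by
  rw [Kernel.trajMeasure, ← Measure.deterministic_comp_eq_map (MeasurableEquiv.measurable _),
    Measure.comp_assoc, Kernel.comp_deterministic_eq_comap]
  rfl

lemma chainKernel_apply (κ : Kernel X X) [IsMarkovKernel κ] (x : X) :
    chainKernel κ x = Kernel.trajMeasure (X := fun _ => X) (Measure.dirac x) (lastStep κ) := by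
  rw [trajMeasure_lastStep, Measure.dirac_bind (Kernel.measurable _)]

/-- `ν` makes the coordinate process a Markov chain with transition kernel `κ`: given the first
`a + 1` entries, the next one has law `κ` of the last of them. -/
def IsChain (κ : Kernel X X) (ν : Measure (ℕ → X)) : Prop :=
  ∀ (a : ℕ) (f : (Finset.Iic a → X) × X → ℝ≥0∞), Measurable f →
    ∫⁻ ω, f (Preorder.frestrictLe a ω, ω (a + 1)) ∂ν =
      ∫⁻ ω, ∫⁻ y, f (Preorder.frestrictLe a ω, y) ∂κ (ω a) ∂ν

lemma isChain_trajMeasure (κ : Kernel X X) [IsMarkovKernel κ] (μ : Measure X)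
    [IsProbabilityMeasure μ] :
    IsChain κ (Kernel.trajMeasure (X := fun _ => X) μ (lastStep κ)) := by
  intro a f hf
  have h := Kernel.map_frestrictLe_trajMeasure_compProd_eq_map_trajMeasure
    (X := fun _ => X) (μ₀ := μ) (κ := lastStep κ) (a := a)
  have h' : ∫⁻ p, f p ∂_ = ∫⁻ p, f p ∂_ := congrArg (fun m => ∫⁻ p, f p ∂m) h
  have hm : Measurable (Preorder.frestrictLe (π := fun _ : ℕ => X) a) := by fun_prop
  rw [Measure.lintegral_compProd hf, lintegral_map hf (by fun_prop),
    lintegral_map hf.lintegral_kernel_prod_right' hm] at h'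
  exact h'.symm

/-- The trajectory with first entry `x` and remaining entries `ω`. -/
def consPath (x : X) (ω : ℕ → X) : ℕ → X
  | 0 => x
  | n + 1 => ω n

lemma measurable_consPath : Measurable (fun p : X × (ℕ → X) => consPath p.1 p.2) := by
  refine measurable_pi_iff.2 fun n => ?_
  cases n with
  | zero => exact measurable_fst
  | succ n => exact (measurable_pi_apply n).comp measurable_snd

lemma measurable_consPath_right (x : X) : Measurable (consPath x) :=
  measurable_consPath.comp (measurable_const.prodMk measurable_id)

/-- The first `a + 2` entries, from the first `a + 1` entries and the next one. -/
def glue (a : ℕ) (p : (Finset.Iic a → X) × X) : Finset.Iic (a + 1) → X :=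
  fun i => if h : (i : ℕ) ≤ a then p.1 ⟨i, Finset.mem_Iic.2 h⟩ else p.2

lemma measurable_glue (a : ℕ) : Measurable (glue (X := X) a) := by
  refine measurable_pi_iff.2 fun i => ?_
  unfold glue
  by_cases h : (i : ℕ) ≤ a
  · simp only [h, dif_pos]; fun_prop
  · simp only [h, dif_neg, not_false_eq_true]; fun_prop

omit [MeasurableSpace X] in
lemma glue_frestrictLe (a : ℕ) (ω : ℕ → X) :
    glue a (Preorder.frestrictLe a ω, ω (a + 1)) = Preorder.frestrictLe (a + 1) ω := by
  ext i
  unfold glue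
  by_cases h : (i : ℕ) ≤ a
  · simp [h, Preorder.frestrictLe]
  · have hi : (i : ℕ) = a + 1 := le_antisymm (Finset.mem_Iic.1 i.2) (by omega)
    simp [Preorder.frestrictLe, hi]

lemma IsChain.ext {κ : Kernel X X} {ν ν' : Measure (ℕ → X)} [IsProbabilityMeasure ν]
    [IsProbabilityMeasure ν'] (hν : IsChain κ ν) (hν' : IsChain κ ν') [IsMarkovKernel κ]
    (h0 : ν.map (fun ω => ω 0) = ν'.map (fun ω => ω 0)) : ν = ν' := by
  have hr : ∀ a, Measurable (Preorder.frestrictLe (π := fun _ : ℕ => X) a) := fun a => by fun_prop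
  have key : ∀ a, ν.map (Preorder.frestrictLe (π := fun _ : ℕ => X) a) =
      ν'.map (Preorder.frestrictLe (π := fun _ : ℕ => X) a) := by
    intro a
    induction a with
    | zero =>
      have hc : (Preorder.frestrictLe (π := fun _ : ℕ => X) 0) =
          (fun (x : X) (_ : Finset.Iic 0) => x) ∘ fun ω : ℕ → X => ω 0 := by
        ext ω i
        have hi : (i : ℕ) = 0 := Nat.le_zero.1 (Finset.mem_Iic.1 i.2)
        simp [Preorder.frestrictLe, hi]
      rw [hc, ← Measure.map_map (by fun_prop) (by fun_prop), h0,
        Measure.map_map (by fun_prop) (by fun_prop)]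
    | succ a ih =>
      have hpair : ν.map (fun ω => (Preorder.frestrictLe (π := fun _ : ℕ => X) a ω, ω (a + 1))) =
          ν'.map (fun ω => (Preorder.frestrictLe (π := fun _ : ℕ => X) a ω, ω (a + 1))) := by
        refine Measure.ext_of_lintegral _ fun f hf => ?_
        rw [lintegral_map hf (by fun_prop), lintegral_map hf (by fun_prop), hν a f hf, hν' a f hf]
        have hg : Measurable fun z : Finset.Iic a → X =>
            ∫⁻ y, f (z, y) ∂lastStep κ a z := hf.lintegral_kernel_prod_right'
        have h1 := lintegral_map (μ := ν) hg (hr a)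
        have h2 := lintegral_map (μ := ν') hg (hr a)
        rw [ih] at h1
        exact h1.symm.trans h2
      have hc : Preorder.frestrictLe (π := fun _ : ℕ => X) (a + 1) = glue a ∘
          fun ω => (Preorder.frestrictLe (π := fun _ : ℕ => X) a ω, ω (a + 1)) :=
        funext fun ω => (glue_frestrictLe a ω).symm
      rw [hc, ← Measure.map_map (measurable_glue a) (by fun_prop), hpair,
        Measure.map_map (measurable_glue a) (by fun_prop)]
  have hI : ∀ I : Finset ℕ, ν.map (I.restrict (π := fun _ : ℕ => X)) =
      ν'.map (I.restrict (π := fun _ : ℕ => X)) := by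
    intro I
    have hsub : I ⊆ Finset.Iic (I.sup id) :=
      fun i hi => Finset.mem_Iic.2 (Finset.le_sup (f := id) hi)
    have hc : I.restrict (π := fun _ : ℕ => X) = Finset.restrict₂ (π := fun _ : ℕ => X) hsub ∘
        Preorder.frestrictLe (π := fun _ : ℕ => X) (I.sup id) := rfl
    have hm : Measurable (Finset.restrict₂ (π := fun _ : ℕ => X) hsub) :=
      Finset.measurable_restrict₂ hsub
    rw [hc, ← Measure.map_map hm (hr _), key, Measure.map_map hm (hr _)]
  have hfin : ∀ I : Finset ℕ, IsFiniteMeasure (ν'.map (I.restrict (π := fun _ : ℕ => X))) :=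
    fun I => inferInstance
  have hl : IsProjectiveLimit ν fun I => ν'.map (I.restrict (π := fun _ : ℕ => X)) := hI
  have hl' : IsProjectiveLimit ν' fun I => ν'.map (I.restrict (π := fun _ : ℕ => X)) :=
    fun _ => rfl
  exact hl.unique hl'

lemma map_eval_zero_trajMeasure (κ : Kernel X X) [IsMarkovKernel κ] (μ : Measure X)
    [IsProbabilityMeasure μ] :
    (Kernel.trajMeasure (X := fun _ => X) μ (lastStep κ)).map (fun ω => ω 0) = μ := by
  have hc : (fun ω : ℕ → X => ω 0) =
      (fun z : Finset.Iic 0 → X => z ⟨0, Finset.mem_Iic.2 le_rfl⟩) ∘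
        Preorder.frestrictLe (π := fun _ : ℕ => X) 0 := rfl
  rw [Kernel.trajMeasure, hc, ← Measure.map_map (by fun_prop) (by fun_prop),
    Measure.map_comp _ _ (by fun_prop), Kernel.traj_map_frestrictLe, Kernel.partialTraj_self,
    Measure.id_comp, Measure.map_map (by fun_prop) (by fun_prop)]
  exact Measure.map_id

/-- First-step decomposition: the chain started in `x` is `x` followed by a chain whose initial
state has law `κ x`. -/
theorem chainKernel_eq_map_consPath (κ : Kernel X X) [IsMarkovKernel κ] (x : X) :
    chainKernel κ x = (chainKernel κ ∘ₘ κ x).map (consPath x) := by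
  have hx := measurable_consPath_right x
  have hP : IsProbabilityMeasure ((chainKernel κ ∘ₘ κ x).map (consPath x)) :=
    Measure.isProbabilityMeasure_map hx.aemeasurable
  have h1 : IsChain κ (chainKernel κ x) := by
    rw [chainKernel_apply]; exact isChain_trajMeasure κ _
  have h2 : IsChain κ ((chainKernel κ ∘ₘ κ x).map (consPath x)) := by
    intro a f hf
    have hr : Measurable (Preorder.frestrictLe (π := fun _ : ℕ => X) a) := by fun_prop
    have hin : Measurable fun ω : ℕ → X =>
        ∫⁻ y, f (Preorder.frestrictLe (π := fun _ : ℕ => X) a ω, y) ∂κ (ω a) := by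
      have hg : Measurable fun z : Finset.Iic a → X =>
          ∫⁻ y, f (z, y) ∂lastStep κ a z := hf.lintegral_kernel_prod_right'
      exact hg.comp hr
    have hout : Measurable fun ω : ℕ → X =>
        f (Preorder.frestrictLe (π := fun _ : ℕ => X) a ω, ω (a + 1)) := hf.comp (by fun_prop)
    rw [lintegral_map hout hx, lintegral_map hin hx]
    cases a with
    | zero =>
      have hconst : ∀ ω : ℕ → X, Preorder.frestrictLe (π := fun _ : ℕ => X) 0 (consPath x ω) =
          fun _ => x := by
        intro ω; ext i
        have hi : (i : ℕ) = 0 := Nat.le_zero.1 (Finset.mem_Iic.1 i.2)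
        simp [Preorder.frestrictLe, hi, consPath]
      simp only [hconst, consPath, lintegral_const, measure_univ, mul_one]
      have hf' : Measurable fun y => f (fun _ => x, y) := hf.comp (by fun_prop)
      rw [← trajMeasure_lastStep]
      conv_rhs => rw [← map_eval_zero_trajMeasure κ (κ x)]
      rw [lintegral_map hf' (by fun_prop)]
    | succ a =>
      set φ : (Finset.Iic a → X) → Finset.Iic (a + 1) → X := fun z i =>
        if h : (i : ℕ) = 0 then x else z ⟨i - 1, Finset.mem_Iic.2 (by
          have := Finset.mem_Iic.1 i.2; omega)⟩ with hφ
      have hφm : Measurable φ := by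
        refine measurable_pi_iff.2 fun i => ?_
        by_cases h : (i : ℕ) = 0
        · simp only [hφ, h, dif_pos]; fun_prop
        · simp only [hφ, h, dif_neg, not_false_eq_true]; fun_prop
      have hφr : ∀ ω : ℕ → X, Preorder.frestrictLe (π := fun _ : ℕ => X) (a + 1) (consPath x ω) =
          φ (Preorder.frestrictLe (π := fun _ : ℕ => X) a ω) := by
        intro ω; ext ⟨i, hi⟩
        cases i with
        | zero => simp [hφ, consPath]
        | succ i => simp [hφ, consPath]
      simp only [hφr]
      have hc : IsChain κ (chainKernel κ ∘ₘ κ x) := by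
        rw [← trajMeasure_lastStep]; exact isChain_trajMeasure κ _
      exact hc a (fun p => f (φ p.1, p.2)) (hf.comp (by fun_prop))
  refine h1.ext h2 ?_
  rw [chainKernel_apply, map_eval_zero_trajMeasure, Measure.map_map (by fun_prop) hx]
  have hc : (fun ω : ℕ → X => ω 0) ∘ consPath x = fun _ => x := rfl
  rw [hc, Measure.map_const, measure_univ, one_smul]

lemma lintegral_chainKernel (κ : Kernel X X) [IsMarkovKernel κ] (x : X) {f : (ℕ → X) → ℝ≥0∞}
    (hf : Measurable f) :
    ∫⁻ ω, f ω ∂chainKernel κ x = ∫⁻ y, ∫⁻ ω, f (consPath x ω) ∂chainKernel κ y ∂κ x := by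
  have hx := measurable_consPath_right x
  conv_lhs => rw [chainKernel_eq_map_consPath]
  have hfx : Measurable fun ω => f (consPath x ω) := hf.comp hx
  rw [lintegral_map hf hx, Measure.lintegral_bind (Kernel.aemeasurable _) hfx.aemeasurable]

lemma measure_chainKernel (κ : Kernel X X) [IsMarkovKernel κ] (x : X) {Z : Set (ℕ → X)}
    (hZ : MeasurableSet Z) :
    chainKernel κ x Z = ∫⁻ y, chainKernel κ y {ω | consPath x ω ∈ Z} ∂κ x := by
  rw [← lintegral_indicator_one hZ, lintegral_chainKernel _ _ (measurable_one.indicator hZ)]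
  exact lintegral_congr fun y => lintegral_indicator_one (measurable_consPath_right x hZ)

end MarkovChain

/-! ### The renewal equation of the transient probabilities -/

namespace CTMC

variable {S C : Type*} [Fintype S] [DecidableEq S]

open scoped Matrix.Norms.Operator in
lemma hasDerivAt_exp_smul_mulVec (A : Matrix S S ℝ) (b : S → ℝ) (t : ℝ) :
    HasDerivAt (fun u : ℝ => (NormedSpace.exp (u • A)).mulVec b)
      (A.mulVec ((NormedSpace.exp (t • A)).mulVec b)) t := by
  have h := hasDerivAt_exp_smul_const' (𝕂 := ℝ) A t
  have hL : IsLinearMap ℝ fun B : Matrix S S ℝ => B.mulVec b :=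
    ⟨fun x y => Matrix.add_mulVec x y b, fun c x => Matrix.smul_mulVec c x b⟩
  have h2 := (LinearMap.toContinuousLinearMap hL.mk').hasFDerivAt.comp_hasDerivAt t h
  rw [Matrix.mulVec_mulVec]
  exact h2

lemma generator_mulVec_apply (M : CTMC S C) (x : S → ℝ) (s : S) :
    M.generator.mulVec x s =
      M.rate s * (∑ s', (M.trans s s').toReal * x s') - M.rate s * x s := by
  rw [generator, Matrix.sub_mulVec, Pi.sub_apply, Matrix.mulVec_diagonal, Finset.mul_sum]
  congr 1
  exact Finset.sum_congr rfl fun s' _ => by simp only [Matrix.of_apply]; ring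

/-- A solution of `x' = Q x` on `[0, ∞)`, with `Q` the generator, is `t ↦ exp (t Q) (x 0)`. -/
lemma eq_exp_mulVec_of_hasDerivAt (M : CTMC S C) {x : ℝ → S → ℝ}
    (hx : ∀ t, 0 ≤ t → HasDerivAt x (M.generator.mulVec (x t)) t) {t : ℝ} (ht : 0 ≤ t) :
    x t = (NormedSpace.exp (t • M.generator)).mulVec (x 0) := by
  have hLip := (LinearMap.toContinuousLinearMap (Matrix.mulVecLin M.generator)).lipschitz
  have hg := hasDerivAt_exp_smul_mulVec M.generator (x 0)
  have h := ODE_solution_unique (a := 0) (b := t) (v := fun _ y => M.generator.mulVec y)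
    (f := x) (g := fun u : ℝ => (NormedSpace.exp (u • M.generator)).mulVec (x 0))
    (fun _ => hLip)
    (fun u hu => (hx u hu.1).continuousAt.continuousWithinAt)
    (fun u hu => (hx u hu.1).hasDerivWithinAt)
    (fun u _ => (hg u).continuousAt.continuousWithinAt)
    (fun u _ => (hg u).hasDerivWithinAt) (by simp)
  exact h ⟨ht, le_rfl⟩

/-- The renewal equation obtained by conditioning on the first jump has only one bounded measurable
solution, given by the matrix exponential of the generator. Bounded solutions are continuous,
hence differentiable, and then satisfy Kolmogorov's backward equation. -/
theorem eq_exp_mulVec_of_renewal (M : CTMC S C) {v : ℝ → S → ℝ} {b : S → ℝ}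
    (hvm : ∀ s, Measurable fun t => v t s) (hvb : ∀ t s, |v t s| ≤ 1)
    (hv : ∀ t, 0 ≤ t → ∀ s, v t s = Real.exp (-(M.rate s * t)) * b s +
      ∫ x in 0..t, M.rate s * Real.exp (-(M.rate s * x)) *
        ∑ s', (M.trans s s').toReal * v (t - x) s') {t : ℝ} (ht : 0 ≤ t) :
    v t = (NormedSpace.exp (t • M.generator)).mulVec b := by
  -- The integrand after the substitution `y = t - x`, with the factor `exp (-E t)` taken out.
  set k : (ℝ → S → ℝ) → S → ℝ → ℝ := fun u s y =>
    M.rate s * Real.exp (M.rate s * y) * ∑ s', (M.trans s s').toReal * u y s' with hk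
  have hv1 : ∀ t, 0 ≤ t → ∀ s,
      v t s = Real.exp (-(M.rate s * t)) * (b s + ∫ y in 0..t, k v s y) := by
    intro t ht s
    rw [hv t ht s, mul_add, ← intervalIntegral.integral_const_mul]
    congr 1
    have := intervalIntegral.integral_comp_sub_left (a := 0) (b := t)
      (fun y => Real.exp (-(M.rate s * t)) * k v s y) t
    rw [sub_self, sub_zero] at this
    rw [← this]
    refine intervalIntegral.integral_congr fun x _ => ?_
    have he : Real.exp (-(M.rate s * x)) =
        Real.exp (-(M.rate s * t)) * Real.exp (M.rate s * (t - x)) := by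
      rw [← Real.exp_add]; congr 1; ring
    simp only [hk, he]; ring
  have hint : ∀ s a c, IntervalIntegrable (k v s) volume a c := by
    intro s a c
    have hf : IntervalIntegrable (fun y => ∑ s', (M.trans s s').toReal * v y s') volume a c := by
      have : IntervalIntegrable (∑ s', fun y => (M.trans s s').toReal * v y s') volume a c := by
        refine IntervalIntegrable.sum _ fun s' _ => IntervalIntegrable.const_mul ?_ _
        rw [intervalIntegrable_iff]
        refine Measure.integrableOn_of_bounded (M := 1) (by simp)
          (hvm s').aestronglyMeasurable (Filter.Eventually.of_forall fun y => ?_)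
        exact hvb y s'
      convert this using 1
      ext y; simp
    exact hf.continuousOn_mul (Continuous.continuousOn (by fun_prop))
  -- `h` extends the restriction of `v` to `[0, ∞)` continuously to the line.
  set h : ℝ → S → ℝ := fun y s => v (max y 0) s with hh
  have hcont : ∀ s, Continuous fun y => h y s := by
    intro s
    have hprim := intervalIntegral.continuous_primitive (hint s) 0
    have : (fun y => h y s) = (fun t => Real.exp (-(M.rate s * t)) *
        (b s + ∫ y in 0..t, k v s y)) ∘ fun y => max y 0 := by
      ext y; exact hv1 _ (le_max_right _ _) s
    rw [this]
    exact Continuous.comp (by fun_prop) (by fun_prop)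
  have hv2 : ∀ t, 0 ≤ t → ∀ s,
      v t s = Real.exp (-(M.rate s * t)) * (b s + ∫ y in 0..t, k h s y) := by
    intro t ht s
    rw [hv1 t ht s]
    congr 2
    refine intervalIntegral.integral_congr fun y hy => ?_
    rw [Set.uIcc_of_le ht] at hy
    simp only [hk, hh, max_eq_left hy.1]
  set w : ℝ → S → ℝ := fun t s => Real.exp (-(M.rate s * t)) * (b s + ∫ y in 0..t, k h s y)
    with hw
  have hder : ∀ t, 0 ≤ t → HasDerivAt w (M.generator.mulVec (w t)) t := by
    intro t ht
    rw [hasDerivAt_pi]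
    intro s
    have hkc : Continuous (k h s) := by
      simp only [hk]
      have := hcont
      fun_prop
    have h1 : HasDerivAt (fun t => ∫ y in 0..t, k h s y) (k h s t) t :=
      intervalIntegral.integral_hasDerivAt_right (hkc.intervalIntegrable _ _)
        (hkc.stronglyMeasurableAtFilter _ _) hkc.continuousAt
    have h2 : HasDerivAt (fun t => Real.exp (-(M.rate s * t)))
        (Real.exp (-(M.rate s * t)) * (-(M.rate s * 1))) t :=
      ((hasDerivAt_id t).const_mul (M.rate s : ℝ)).neg.exp
    have h3 := h2.mul (h1.const_add (b s))
    refine h3.congr_deriv ?_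
    have hwt : ∀ s', h t s' = w t s' := by
      intro s'
      simp only [hh, max_eq_left ht]
      exact hv2 t ht s'
    have he : Real.exp (-(M.rate s * t)) * Real.exp (M.rate s * t) = 1 := by
      rw [← Real.exp_add]; simp
    rw [generator_mulVec_apply]
    have hkt : k h s t = M.rate s * Real.exp (M.rate s * t) *
        ∑ s', (M.trans s s').toReal * w t s' := by
      simp only [hk, hwt]
    rw [hkt]
    simp only [hw]
    linear_combination (M.rate s : ℝ) * (∑ s', (M.trans s s').toReal * w t s') * he
  have hw0 : w 0 = b := by ext s; simp [hw]
  have := M.eq_exp_mulVec_of_hasDerivAt hder ht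
  rw [hw0] at this
  rw [← this]
  ext s
  exact hv2 t ht s

end CTMC

/-! ### Exponential residence times -/

namespace CTMC

variable {S C : Type*}

lemma lintegral_residence (M : CTMC S C) (s : S) (hr : M.rate s ≠ 0) {F : ℝ≥0∞ → ℝ≥0∞}
    (hF : Measurable F) :
    ∫⁻ τ, F τ ∂M.residence s =
      ∫⁻ x in Set.Ioi 0, ENNReal.ofReal (M.rate s * Real.exp (-(M.rate s * x))) *
        F (ENNReal.ofReal x) := by
  have hm : Measurable (gammaPDF 1 (M.rate s)) :=
    (measurable_gammaPDFReal 1 (M.rate s)).ennreal_ofReal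
  have hFo : Measurable fun x => F (ENNReal.ofReal x) := hF.comp ENNReal.measurable_ofReal
  rw [residence, if_neg hr, lintegral_map hF ENNReal.measurable_ofReal, expMeasure, gammaMeasure,
    lintegral_withDensity_eq_lintegral_mul _ hm hFo]
  rw [← lintegral_add_compl _ (measurableSet_Ici (a := (0 : ℝ))), Set.compl_Ici]
  have h0 : ∫⁻ x in Set.Iio (0 : ℝ), (gammaPDF 1 (M.rate s) * fun x => F (ENNReal.ofReal x)) x
      = 0 := by
    rw [setLIntegral_congr_fun (g := 0) measurableSet_Iio fun x hx => ?_]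
    · simp
    · simp [gammaPDF_of_neg hx]
  rw [h0, add_zero, ← setLIntegral_congr Ioi_ae_eq_Ici]
  refine setLIntegral_congr_fun measurableSet_Ioi fun x hx => ?_
  have hx' : (0 : ℝ) ≤ x := le_of_lt hx
  have := exponentialPDF_of_nonneg (r := M.rate s) hx'
  rw [exponentialPDF, exponentialPDFReal] at this
  simp only [Pi.mul_apply, gammaPDF, this]

/-- Conditioning on whether the residence time in `s` exceeds `t`. On `t < τ` the exponential
distribution is memoryless, so `τ - t` is again distributed like the residence time. If the rate
is `0` then `τ = ∞ = ∞ - t` and only this case occurs. -/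
lemma lintegral_residence_split (M : CTMC S C) (s : S) (t : ℝ≥0) {F G : ℝ≥0∞ → ℝ≥0∞}
    (hF : Measurable F) (hG : Measurable G) (c : ℝ≥0∞)
    (hFG : ∀ τ, (t : ℝ≥0∞) < τ → F τ = c * G (τ - t)) :
    ∫⁻ τ, F τ ∂M.residence s =
      ENNReal.ofReal (Real.exp (-(M.rate s * t))) * (c * ∫⁻ τ, G τ ∂M.residence s) +
      ∫⁻ x in Set.Ioc 0 (t : ℝ), ENNReal.ofReal (M.rate s * Real.exp (-(M.rate s * x))) *
        F (ENNReal.ofReal x) := by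
  by_cases hr : M.rate s = 0
  · have hd : M.residence s = Measure.dirac ∞ := by rw [residence, if_pos hr]
    rw [hd, lintegral_dirac' _ hF, lintegral_dirac' _ hG, hFG ∞ ENNReal.coe_lt_top]
    simp [hr]
  · rw [M.lintegral_residence s hr hF, M.lintegral_residence s hr hG]
    have ht : (0 : ℝ) ≤ t := t.coe_nonneg
    rw [← Set.Ioc_union_Ioi_eq_Ioi ht, lintegral_union measurableSet_Ioi
      (Set.Ioc_disjoint_Ioi_same), add_comm, Set.Ioc_union_Ioi_eq_Ioi ht]
    congr 1
    have hGo : Measurable fun x : ℝ => ENNReal.ofReal (M.rate s * Real.exp (-(M.rate s * x))) *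
        G (ENNReal.ofReal x) := by fun_prop
    rw [← lintegral_indicator measurableSet_Ioi, ← lintegral_indicator measurableSet_Ioi,
      ← lintegral_const_mul _ (hGo.indicator measurableSet_Ioi),
      ← lintegral_const_mul _ ((hGo.indicator measurableSet_Ioi).const_mul c),
      ← lintegral_add_right_eq_self _ (t : ℝ)]
    refine lintegral_congr fun x => ?_
    by_cases hx : 0 < x
    · have hx' : x + t ∈ Set.Ioi (t : ℝ) := by simpa using hx
      have hlt : (t : ℝ≥0∞) < ENNReal.ofReal (x + t) := by
        rw [← ENNReal.ofReal_coe_nnreal, ENNReal.ofReal_lt_ofReal_iff (by linarith)]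
        exact hx'
      have hsub : ENNReal.ofReal (x + t) - t = ENNReal.ofReal x := by
        rw [ENNReal.ofReal_add hx.le ht, ENNReal.ofReal_coe_nnreal, ENNReal.add_sub_cancel_right
          ENNReal.coe_ne_top]
      have he : (M.rate s : ℝ) * Real.exp (-(M.rate s * (x + t))) =
          Real.exp (-(M.rate s * t)) * (M.rate s * Real.exp (-(M.rate s * x))) := by
        rw [show -((M.rate s : ℝ) * (x + t)) = -(M.rate s * t) + -(M.rate s * x) by ring,
          Real.exp_add]
        ring
      rw [Set.indicator_of_mem hx', Set.indicator_of_mem (Set.mem_Ioi.2 hx), hFG _ hlt, hsub, he,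
        ENNReal.ofReal_mul (Real.exp_nonneg _)]
      ring
    · have hx' : x + t ∉ Set.Ioi (t : ℝ) := by simpa using hx
      rw [Set.indicator_of_notMem hx', Set.indicator_of_notMem (by simpa using hx)]
      simp

/-! ### Timed paths and occupied states -/

/-- The time at which a timed path enters its `n`-th state. -/
def Path.entryTime (π : Path S) (n : ℕ) : ℝ≥0∞ := ∑ k ∈ Finset.range n, (π k).2

/-- At time `t` the path is in one of its states, and that state belongs to `A`. Unlike
`Path.stateAt`, this fails by definition for a path that explodes before time `t`, so that it is
compatible with removing the first state of the path. -/
def Path.OccupiesAt (π : Path S) (t : ℝ≥0) (A : Set S) : Prop :=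
  ∃ n, π.entryTime n ≤ t ∧ (t : ℝ≥0∞) < π.entryTime (n + 1) ∧ (π n).1 ∈ A

open MarkovChain (consPath)

lemma Path.entryTime_consPath_succ (p : S × ℝ≥0∞) (ω : Path S) (n : ℕ) :
    Path.entryTime (consPath p ω) (n + 1) = p.2 + Path.entryTime ω n := by
  rw [Path.entryTime, Finset.sum_range_succ', add_comm]
  rfl

lemma Path.occupiesAt_consPath_of_lt {s : S} {τ : ℝ≥0∞} {t : ℝ≥0} (h : (t : ℝ≥0∞) < τ)
    (ω : Path S) (A : Set S) : Path.OccupiesAt (consPath (s, τ) ω) t A ↔ s ∈ A := by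
  constructor
  · rintro ⟨n, h1, -, h3⟩
    cases n with
    | zero => exact h3
    | succ n =>
      rw [Path.entryTime_consPath_succ] at h1
      exact absurd (le_self_add.trans h1) (not_le.2 h)
  · intro hs
    refine ⟨0, by simp [Path.entryTime], ?_, hs⟩
    rw [Path.entryTime_consPath_succ]
    exact h.trans_le le_self_add

lemma Path.occupiesAt_consPath_of_le {s : S} {x t : ℝ≥0} (h : x ≤ t) (ω : Path S) (A : Set S) :
    Path.OccupiesAt (consPath (s, (x : ℝ≥0∞)) ω) t A ↔ Path.OccupiesAt ω (t - x) A := by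
  have hle : ∀ y : ℝ≥0∞, (x : ℝ≥0∞) + y ≤ t ↔ y ≤ ((t - x : ℝ≥0) : ℝ≥0∞) := by
    intro y
    conv_lhs => rw [← add_tsub_cancel_of_le h, ENNReal.coe_add]
    exact ENNReal.add_le_add_iff_left ENNReal.coe_ne_top
  have hlt : ∀ y : ℝ≥0∞, (t : ℝ≥0∞) < x + y ↔ ((t - x : ℝ≥0) : ℝ≥0∞) < y := by
    intro y; rw [← not_le, hle, not_le]
  constructor
  · rintro ⟨n, h1, h2, h3⟩
    rw [Path.entryTime_consPath_succ, hlt] at h2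
    cases n with
    | zero => simp [Path.entryTime] at h2
    | succ n =>
      rw [Path.entryTime_consPath_succ, hle] at h1
      exact ⟨n, h1, h2, h3⟩
  · rintro ⟨n, h1, h2, h3⟩
    refine ⟨n + 1, ?_, ?_, h3⟩
    · rw [Path.entryTime_consPath_succ, hle]; exact h1
    · rw [Path.entryTime_consPath_succ, hlt]; exact h2

/-- If the first state is not left until time `t`, then shortening its residence time by `t`
shifts the path by `t`. -/
lemma Path.occupiesAt_consPath_add {s : S} {τ : ℝ≥0∞} {t : ℝ≥0} (h : (t : ℝ≥0∞) < τ) (u : ℝ≥0)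
    (ω : Path S) (A : Set S) :
    Path.OccupiesAt (consPath (s, τ) ω) (t + u) A ↔
      Path.OccupiesAt (consPath (s, τ - t) ω) u A := by
  by_cases h' : ((t + u : ℝ≥0) : ℝ≥0∞) < τ
  · rw [Path.occupiesAt_consPath_of_lt h', Path.occupiesAt_consPath_of_lt]
    rw [ENNReal.coe_add] at h'
    exact lt_tsub_iff_left.2 h'
  · rw [not_lt] at h'
    lift τ to ℝ≥0 using ne_top_of_le_ne_top ENNReal.coe_ne_top h'
    have h1 : t < τ := by exact_mod_cast h
    have h2 : τ ≤ t + u := by exact_mod_cast h'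
    rw [← ENNReal.coe_sub, Path.occupiesAt_consPath_of_le h2,
      Path.occupiesAt_consPath_of_le (tsub_le_iff_left.2 h2)]
    congr! 1
    apply NNReal.coe_injective
    rw [NNReal.coe_sub h2, NNReal.coe_sub (tsub_le_iff_left.2 h2), NNReal.coe_sub h1.le,
      NNReal.coe_add]
    ring

lemma Path.OccupiesAt.stateAt_mem {π : Path S} {t : ℝ≥0} {A : Set S} (h : π.OccupiesAt t A) :
    π.stateAt t ∈ A := by
  classical
  obtain ⟨n, h1, h2, h3⟩ := h
  have hex : ∃ n, (t : ℝ≥0∞) < ∑ k ∈ Finset.range (n + 1), (π k).2 := ⟨n, h2⟩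
  have hn : Nat.find hex = n := by
    refine (Nat.find_eq_iff hex).2 ⟨h2, fun m hm hlt => ?_⟩
    refine absurd (hlt.trans_le ?_) (not_lt.2 h1)
    exact Finset.sum_le_sum_of_subset (Finset.range_subset_range.2 hm)
  rw [Path.stateAt, dif_pos hex]
  convert h3

lemma Path.occupiesAt_iff {π : Path S} {t : ℝ≥0} (h : π.OccupiesAt t Set.univ) (A : Set S) :
    π.OccupiesAt t A ↔ π.stateAt t ∈ A := by
  refine ⟨fun h => h.stateAt_mem, fun hA => ?_⟩
  obtain ⟨n, h1, h2, -⟩ := h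
  exact ⟨n, h1, h2, by
    have : π.OccupiesAt t {(π n).1} := ⟨n, h1, h2, rfl⟩
    rw [← Set.mem_singleton_iff.1 this.stateAt_mem]; exact hA⟩

variable [MeasurableSpace S] [DiscreteMeasurableSpace S]

omit [DiscreteMeasurableSpace S] in
lemma Path.measurable_entryTime (n : ℕ) : Measurable fun π : Path S => π.entryTime n := by
  unfold Path.entryTime; fun_prop

lemma Path.measurableSet_occupiesAt (A : Set S) :
    MeasurableSet {p : ℝ≥0 × Path S | p.2.OccupiesAt p.1 A} := by
  have : {p : ℝ≥0 × Path S | p.2.OccupiesAt p.1 A} = ⋃ n,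
      {p : ℝ≥0 × Path S | p.2.entryTime n ≤ p.1} ∩ ({p | (p.1 : ℝ≥0∞) < p.2.entryTime (n + 1)} ∩
        {p | (p.2 n).1 ∈ A}) := by
    ext p; simp [Path.OccupiesAt]
  rw [this]
  have hc : Measurable fun p : ℝ≥0 × Path S => (p.1 : ℝ≥0∞) := by fun_prop
  have he : ∀ n, Measurable fun p : ℝ≥0 × Path S => p.2.entryTime n :=
    fun n => (Path.measurable_entryTime n).comp measurable_snd
  refine MeasurableSet.iUnion fun n => (measurableSet_le (he n) hc).inter
    ((measurableSet_lt hc (he (n + 1))).inter ?_)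
  have hm : Measurable fun p : ℝ≥0 × Path S => (p.2 n).1 := by fun_prop
  exact hm (MeasurableSet.of_discrete (s := A))

/-! ### The first jump -/

/-- The law of the timed paths that start in `s`. -/
def pathFrom (M : CTMC S C) (s : S) : Measure (Path S) :=
  MarkovChain.chainKernel (M.jumpKernel.comap Prod.fst measurable_fst) ∘ₘ
    (M.residence s).map (Prod.mk s)

instance (M : CTMC S C) (s : S) : IsProbabilityMeasure (M.pathFrom s) := by
  have : IsProbabilityMeasure ((M.residence s).map (Prod.mk s)) :=
    Measure.isProbabilityMeasure_map (by fun_prop)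
  unfold pathFrom; infer_instance

lemma pathMeasure_eq_pathFrom (M : CTMC S C) : M.pathMeasure = M.pathFrom M.init := by
  have h : Measure.dirac M.init ⊗ₘ M.residenceKernel =
      (M.residence M.init).map (Prod.mk M.init) := by
    refine Measure.ext_of_lintegral _ fun f hf => ?_
    rw [Measure.lintegral_compProd hf, lintegral_dirac' _ hf.lintegral_kernel_prod_right',
      lintegral_map hf (by fun_prop)]
    rfl
  rw [pathMeasure, h]
  exact MarkovChain.trajMeasure_lastStep (M.jumpKernel.comap Prod.fst measurable_fst) _

variable [Fintype S]

/-- First-step decomposition of a CTMC: the residence time in `s`, then a jump to `s'`, then an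
independent path from `s'`. -/
lemma lintegral_pathFrom (M : CTMC S C) (s : S) {f : Path S → ℝ≥0∞} (hf : Measurable f) :
    ∫⁻ π, f π ∂M.pathFrom s =
      ∫⁻ τ, ∑ s', M.trans s s' * ∫⁻ ω, f (consPath (s, τ) ω) ∂M.pathFrom s' ∂M.residence s := by
  have hk : ∀ (s' : S) {g : Path S → ℝ≥0∞}, Measurable g → ∫⁻ π, g π ∂M.pathFrom s' =
      ∫⁻ τ, ∫⁻ ω, g ω ∂MarkovChain.chainKernel (M.jumpKernel.comap Prod.fst measurable_fst) (s', τ)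
        ∂M.residence s' := by
    intro s' g hg
    rw [pathFrom, Measure.lintegral_bind (Kernel.aemeasurable _) hg.aemeasurable,
      lintegral_map hg.lintegral_kernel (by fun_prop)]
  rw [hk s hf]
  refine lintegral_congr fun τ => ?_
  have hfc : Measurable fun ω => f (consPath (s, τ) ω) :=
    hf.comp (MarkovChain.measurable_consPath_right _)
  rw [MarkovChain.lintegral_chainKernel _ _ hf]
  change ∫⁻ y, _ ∂((M.trans s).toMeasure ⊗ₘ M.residenceKernel) = _
  rw [Measure.lintegral_compProd hfc.lintegral_kernel, lintegral_fintype]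
  refine Finset.sum_congr rfl fun s' _ => ?_
  rw [PMF.toMeasure_apply_singleton _ _ (MeasurableSet.singleton s'), mul_comm, hk s' hfc]
  rfl

end CTMC

/-! ### The Markov property at a deterministic time -/

namespace CTMC

open MarkovChain (consPath)

variable {S C : Type*} [Fintype S] [MeasurableSpace S] [DiscreteMeasurableSpace S]

lemma measure_pathFrom (M : CTMC S C) (s : S) {Z : Set (Path S)} (hZ : MeasurableSet Z) :
    M.pathFrom s Z = ∫⁻ τ, ∑ s', M.trans s s' * M.pathFrom s' {ω | consPath (s, τ) ω ∈ Z}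
      ∂M.residence s := by
  rw [← lintegral_indicator_one hZ, M.lintegral_pathFrom s (measurable_one.indicator hZ)]
  refine lintegral_congr fun τ => Finset.sum_congr rfl fun s' _ => ?_
  congr 1
  exact lintegral_indicator_one (MarkovChain.measurable_consPath_right (s, τ) hZ)

lemma measurable_sum_trans_mul (M : CTMC S C) (s : S) {Z : Set (Path S)} (hZ : MeasurableSet Z) :
    Measurable fun τ => ∑ s', M.trans s s' * M.pathFrom s' {ω | consPath (s, τ) ω ∈ Z} := by
  refine Finset.measurable_sum _ fun s' _ => Measurable.const_mul ?_ _
  have hm : Measurable fun p : ℝ≥0∞ × Path S => consPath (s, p.1) p.2 :=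
    MarkovChain.measurable_consPath.comp ((measurable_const.prodMk measurable_fst).prodMk
      measurable_snd)
  exact measurable_measure_prodMk_left (hm hZ)

variable [DecidableEq S]

/-- Markov property: given the state `s'` at time `t`, the path after time `t` behaves like a path
from `s'`. The probability on the left, as a function of `s` and `t`, solves the renewal equation
obtained by conditioning on the first jump. -/
theorem pathFrom_occupiesAt_and (M : CTMC S C) {ι : Type*} [Countable ι] (A : Set S)
    (u : ι → ℝ≥0) (B : ι → Set S) (s : S) (t : ℝ≥0) :
    M.pathFrom s {π | π.OccupiesAt t A ∧ ∀ i, π.OccupiesAt (t + u i) (B i)} =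
      ∑ s', M.transient s t s' *
        A.indicator (fun s' => M.pathFrom s' {π | ∀ i, π.OccupiesAt (u i) (B i)}) s' := by
  set Z : Set (ℝ≥0 × Path S) :=
    {p | p.2.OccupiesAt p.1 A ∧ ∀ i, p.2.OccupiesAt (p.1 + u i) (B i)} with hZdef
  set Z₀ : Set (Path S) := {π | ∀ i, π.OccupiesAt (u i) (B i)} with hZ₀def
  have hZ : MeasurableSet Z := by
    rw [show Z = {p : ℝ≥0 × Path S | p.2.OccupiesAt p.1 A} ∩
      ⋂ i, {p : ℝ≥0 × Path S | p.2.OccupiesAt (p.1 + u i) (B i)} by ext p; simp [hZdef]]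
    refine (Path.measurableSet_occupiesAt A).inter (MeasurableSet.iInter fun i => ?_)
    have hm : Measurable fun p : ℝ≥0 × Path S => (p.1 + u i, p.2) := by fun_prop
    exact hm (Path.measurableSet_occupiesAt (B i))
  have hZt : ∀ t : ℝ≥0, MeasurableSet {π | (t, π) ∈ Z} := fun t => measurable_prodMk_left hZ
  have hZ₀ : MeasurableSet Z₀ := by
    rw [show Z₀ = ⋂ i, {π : Path S | π.OccupiesAt (u i) (B i)} by ext p; simp [hZ₀def]]
    refine MeasurableSet.iInter fun i => ?_
    have hm : Measurable fun π : Path S => (u i, π) := measurable_prodMk_left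
    exact hm (Path.measurableSet_occupiesAt (B i))
  set b : S → ℝ := A.indicator fun s' => (M.pathFrom s' Z₀).toReal with hb
  set v : ℝ → S → ℝ := fun x s => (M.pathFrom s {π | (x.toNNReal, π) ∈ Z}).toReal with hv
  have hvm : ∀ s, Measurable fun x => v x s := fun s =>
    ((measurable_measure_prodMk_left hZ).comp measurable_real_toNNReal).ennreal_toReal
  have hv1 : ∀ x s, v x s ≤ 1 := fun x s => ENNReal.toReal_le_of_le_ofReal zero_le_one
    (by simpa using prob_le_one)
  have hv0 : ∀ x s, 0 ≤ v x s := fun x s => ENNReal.toReal_nonneg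
  have hren : ∀ x, 0 ≤ x → ∀ s, v x s = Real.exp (-(M.rate s * x)) * b s +
      ∫ y in 0..x, M.rate s * Real.exp (-(M.rate s * y)) *
        ∑ s', (M.trans s s').toReal * v (x - y) s' := by
    intro x hx s
    lift x to ℝ≥0 using hx
    have h := M.lintegral_residence_split s x (M.measurable_sum_trans_mul s (hZt x))
      (M.measurable_sum_trans_mul s hZ₀) (A.indicator 1 s) fun τ hτ => by
        by_cases hs : s ∈ A
        · rw [Set.indicator_of_mem hs, Pi.one_apply, one_mul]
          refine Finset.sum_congr rfl fun s' _ => ?_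
          congr 2
          ext ω
          simp only [hZdef, hZ₀def, Set.mem_ofPred_eq, Path.occupiesAt_consPath_of_lt hτ,
            Path.occupiesAt_consPath_add hτ, hs, true_and]
        · rw [Set.indicator_of_notMem hs, zero_mul]
          refine Finset.sum_eq_zero fun s' _ => ?_
          have : {ω | consPath (s, τ) ω ∈ {π | (x, π) ∈ Z}} = ∅ := by
            ext ω
            simp [hZdef, Path.occupiesAt_consPath_of_lt hτ, hs]
          rw [this, measure_empty, mul_zero]
    rw [← M.measure_pathFrom s (hZt x), ← M.measure_pathFrom s hZ₀] at h
    have hq : ∀ y ∈ Set.Ioc (0 : ℝ) x,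
        ENNReal.ofReal (M.rate s * Real.exp (-(M.rate s * y))) *
          ∑ s', M.trans s s' *
            M.pathFrom s' {ω | consPath (s, ENNReal.ofReal y) ω ∈ {π | (x, π) ∈ Z}} =
        ENNReal.ofReal (M.rate s * Real.exp (-(M.rate s * y)) *
          ∑ s', (M.trans s s').toReal * v (x - y) s') := by
      intro y hy
      have hpos : 0 ≤ M.rate s * Real.exp (-(M.rate s * y)) := by positivity
      rw [ENNReal.ofReal_mul hpos, ENNReal.ofReal_sum_of_nonneg
        fun s' _ => mul_nonneg ENNReal.toReal_nonneg (hv0 _ _)]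
      congr 1
      refine Finset.sum_congr rfl fun s' _ => ?_
      rw [ENNReal.ofReal_mul ENNReal.toReal_nonneg, ENNReal.ofReal_toReal (PMF.apply_ne_top _ _)]
      simp only [hv]
      rw [ENNReal.ofReal_toReal (measure_ne_top _ _)]
      congr 2
      ext ω
      have hyx : y.toNNReal ≤ x := by
        rw [← Real.toNNReal_coe (r := x)]; exact Real.toNNReal_le_toNNReal hy.2
      have hxy : ((x : ℝ) - y).toNNReal = x - y.toNNReal := by
        rw [NNReal.sub_def, Real.coe_toNNReal _ hy.1.le]
      have hadd : ∀ i, x + u i - y.toNNReal = x - y.toNNReal + u i :=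
        fun i => (tsub_add_eq_add_tsub hyx).symm
      simp only [hZdef, Set.mem_ofPred_eq, ENNReal.ofReal, hxy,
        Path.occupiesAt_consPath_of_le hyx, Path.occupiesAt_consPath_of_le
          (hyx.trans (le_self_add (a := x))), hadd]
    rw [setLIntegral_congr_fun measurableSet_Ioc hq] at h
    have hnn : ∀ y, 0 ≤ M.rate s * Real.exp (-(M.rate s * y)) *
        ∑ s', (M.trans s s').toReal * v (x - y) s' := fun y =>
      mul_nonneg (by positivity)
        (Finset.sum_nonneg fun s' _ => mul_nonneg ENNReal.toReal_nonneg (hv0 _ _))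
    have hmeas : Measurable fun y => M.rate s * Real.exp (-(M.rate s * y)) *
        ∑ s', (M.trans s s').toReal * v (x - y) s' := by
      refine Measurable.mul (by fun_prop) (Finset.measurable_sum _ fun s' _ => ?_)
      exact ((hvm s').comp (measurable_const.sub measurable_id)).const_mul _
    have hfin : M.pathFrom s {π | (x, π) ∈ Z} ≠ ∞ := measure_ne_top _ _
    have h' := congrArg ENNReal.toReal h
    rw [h, ENNReal.add_ne_top] at hfin
    rw [ENNReal.toReal_add hfin.1 hfin.2, ← integral_eq_lintegral_of_nonneg_ae
      (Filter.Eventually.of_forall hnn) hmeas.aestronglyMeasurable,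
      ← intervalIntegral.integral_of_le x.coe_nonneg, ENNReal.toReal_mul,
      ENNReal.toReal_ofReal (Real.exp_nonneg _), ENNReal.toReal_mul] at h'
    simp only [hv, Real.toNNReal_coe] at h' ⊢
    rw [h']
    congr 2
    by_cases hs : s ∈ A <;> simp [hb, hs]
  have hsol := congrFun (M.eq_exp_mulVec_of_renewal hvm
    (fun x s => abs_le.2 ⟨by linarith [hv0 x s], hv1 x s⟩) hren t.coe_nonneg) s
  have hb0 : ∀ s', 0 ≤ b s' := fun s' => Set.indicator_nonneg (fun _ _ => ENNReal.toReal_nonneg) _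
  have : M.pathFrom s {π | (t, π) ∈ Z} = ENNReal.ofReal (v t s) := by
    simp only [hv, Real.toNNReal_coe]
    rw [ENNReal.ofReal_toReal (measure_ne_top _ _)]
  change M.pathFrom s {π | (t, π) ∈ Z} = _
  rw [this, hsol]
  change ENNReal.ofReal (∑ s', M.transientProb s t s' * b s') = _
  rw [ENNReal.ofReal_sum_of_nonneg fun s' _ => mul_nonneg (M.transientProb_nonneg s t s') (hb0 s')]
  refine Finset.sum_congr rfl fun s' _ => ?_
  rw [ENNReal.ofReal_mul (M.transientProb_nonneg s t s')]
  congr 1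
  by_cases hs : s' ∈ A
  · simp [hb, hs, ENNReal.ofReal_toReal]
  · simp [hb, hs]

/-- A path almost surely does not explode before time `t`. -/
lemma ae_occupiesAt_univ (M : CTMC S C) (s : S) (t : ℝ≥0) :
    ∀ᵐ π ∂M.pathFrom s, π.OccupiesAt t Set.univ := by
  have h := M.pathFrom_occupiesAt_and Set.univ (ι := Empty) Empty.elim Empty.elim s t
  have h1 : ∑ s', M.transient s t s' = 1 := by
    rw [← tsum_fintype (L := .unconditional S)]; exact PMF.tsum_coe _
  simp [h1] at h
  have hm : MeasurableSet {π : Path S | π.OccupiesAt t Set.univ} :=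
    measurable_prodMk_left (x := t) (Path.measurableSet_occupiesAt Set.univ)
  exact (prob_compl_eq_zero_iff hm).2 h

end CTMC

/-! ### The node sequence of precise evidence -/

namespace Evidence

variable {C : Type*} {d : ℕ}

lemma time_strictMono (ρ : Evidence C d) : StrictMono ρ.time := by
  have h : ∀ (m : ℕ) (i j : Fin d), (i : ℕ) + m + 1 = j → ρ.time i < ρ.time j := by
    intro m
    induction m with
    | zero => exact fun i j hij => ρ.time_lt i j hij
    | succ m ih =>
      intro i j hij
      have hj := j.2
      exact (ih i ⟨i + m + 1, by omega⟩ rfl).trans (ρ.time_lt _ j (by simpa using by omega))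
  intro i j hij
  have : (i : ℕ) < j := hij
  exact h (j - i - 1) i j (by omega)

/-- The real time of the `k`-th node `0, t₁, …, t_d` of the evidence graph; constantly `t_d` for
`k > d`. -/
def obsTime [NeZero d] (ρ : Evidence C d) : ℕ → ℝ≥0
  | 0 => 0
  | k + 1 => ρ.time ⟨min k (d - 1), by have := NeZero.pos d; omega⟩

/-- The node sequence `0, t₁, …, t_d, t⋆, t⋆, …` of the evidence graph. -/
def node (ρ : Evidence C d) : ℕ → TimePoint
  | 0 => 0
  | k + 1 => if h : k < d then (ρ.time ⟨k, h⟩ : TimePoint) else ⊤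

lemma node_of_gt (ρ : Evidence C d) {k : ℕ} (h : d < k) : ρ.node k = ⊤ := by
  cases k with
  | zero => omega
  | succ k => simp only [node]; rw [dif_neg (by omega)]

lemma node_succ (ρ : Evidence C d) (i : Fin d) : ρ.node (i + 1) = ρ.time i := by
  rw [node, dif_pos i.2]

lemma node_lt_succ (ρ : Evidence C d) {k : ℕ} (h : k ≤ d) : ρ.node k < ρ.node (k + 1) := by
  cases k with
  | zero =>
    by_cases hd : 0 < d
    · simp only [node, hd, dif_pos]; exact_mod_cast ρ.time_pos _
    · simp [node, hd]
  | succ k =>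
    have hk : k < d := h
    by_cases hd : k + 1 < d
    · simp only [node, hk, hd, dif_pos]; exact_mod_cast ρ.time_lt _ _ rfl
    · simp only [node, hk, hd, dif_pos, dif_neg, not_false_eq_true]; exact WithTop.coe_lt_top _

lemma node_inj (ρ : Evidence C d) {j k : ℕ} (hj : j ≤ d) (h : ρ.node j = ρ.node k) : j = k := by
  have key : ∀ a b, a < b → a ≤ d → ρ.node a < ρ.node b := by
    intro a b hab ha
    induction b, hab using Nat.le_induction with
    | base => exact ρ.node_lt_succ ha
    | succ b hb ih =>
      by_cases hbd : b ≤ d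
      · exact ih.trans (ρ.node_lt_succ hbd)
      · rwa [ρ.node_of_gt (k := b + 1) (by omega), ← ρ.node_of_gt (k := b) (by omega)]
  rcases lt_trichotomy j k with hlt | rfl | hlt
  · exact absurd h (key j k hlt hj).ne
  · rfl
  · exact absurd h (key k j hlt (by omega)).ne'

variable [NeZero d]

lemma obsTime_succ (ρ : Evidence C d) (i : Fin d) : ρ.obsTime (i + 1) = ρ.time i := by
  have := i.2
  simp only [obsTime]
  congr 1
  ext
  simp only
  omega

lemma monotone_obsTime (ρ : Evidence C d) : Monotone ρ.obsTime := by
  refine monotone_nat_of_le_succ fun k => ?_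
  cases k with
  | zero => exact zero_le
  | succ k =>
    refine ρ.time_strictMono.monotone ?_
    rw [Fin.mk_le_mk]
    omega

lemma node_eq_obsTime (ρ : Evidence C d) {k : ℕ} (h : k ≤ d) :
    ρ.node k = (ρ.obsTime k : TimePoint) := by
  cases k with
  | zero => rfl
  | succ k => exact (ρ.node_succ ⟨k, h⟩).trans (by rw [← ρ.obsTime_succ])

lemma node_edge (ρ : Evidence C d) {k : ℕ} (h : k ≤ d) :
    ρ.graph.Edge (ρ.node k) (ρ.node (k + 1)) := by
  have hd := NeZero.pos d
  cases k with
  | zero => exact Or.inl ⟨rfl, ρ.node_succ ⟨0, hd⟩⟩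
  | succ k =>
    by_cases hk : k + 1 < d
    · exact Or.inr (Or.inl ⟨⟨k, h⟩, ⟨k + 1, hk⟩, rfl, ρ.node_succ ⟨k, h⟩, ρ.node_succ ⟨k + 1, hk⟩⟩)
    · refine Or.inr (Or.inr ⟨?_, ρ.node_of_gt (by omega)⟩)
      rw [ρ.node_succ ⟨k, h⟩, lastTime]
      congr 3
      omega

/-- The states compatible with the `i`-th observation. -/
def compatible {S : Type*} (M : CTMC S C) (ρ : Evidence C d) (i : ℕ) : Set S :=
  {s | ∀ h : i < d, M.label s = ρ.label ⟨i, h⟩}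

/-- The states compatible with the `i`-th observation and, for the last observation, equal to
`s`. -/
def compatibleEnding {S : Type*} (M : CTMC S C) (ρ : Evidence C d) (s : S) (i : ℕ) : Set S :=
  ρ.compatible M i ∩ {s' | i + 1 = d → s' = s}

omit [NeZero d] in
lemma forall_mem_compatible {S : Type*} (M : CTMC S C) (ρ : Evidence C d) (f : Fin d → S) :
    (∀ i : Fin d, f i ∈ ρ.compatible M (0 + i)) ↔ ∀ i, M.label (f i) = ρ.label i := by
  refine forall_congr' fun i => ?_
  simp [compatible]

lemma forall_mem_compatibleEnding {S : Type*} (M : CTMC S C) (ρ : Evidence C d) (s : S)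
    (f : Fin d → S) : (∀ i : Fin d, f i ∈ ρ.compatibleEnding M s (0 + i)) ↔
      (∀ i, M.label (f i) = ρ.label i) ∧ f (lastIdx d) = s := by
  rw [← forall_mem_compatible]
  have hd := NeZero.pos d
  constructor
  · exact fun h => ⟨fun i => (h i).1, (h (lastIdx d)).2 (by simp only; omega)⟩
  · rintro ⟨h1, h2⟩ i
    refine ⟨h1 i, fun hi => ?_⟩
    have : i = lastIdx d := by ext; simp only; omega
    rw [this]; exact h2

end Evidence

/-! ### Finite-dimensional distributions of the CTMC -/

/-- A conditional probability only depends on the condition and on the joint event up to null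
sets. -/
lemma ProbabilityTheory.cond_apply_of_ae_eq {Ω : Type*} [MeasurableSpace Ω] {μ : Measure Ω} {E F F' D : Set Ω}
    (hF' : MeasurableSet F') (hF : F =ᵐ[μ] F') (hD : (F ∩ E : Set Ω) =ᵐ[μ] D) :
    μ[E | F] = (μ F')⁻¹ * μ D := by
  have h : μ[|F] = μ[|F'] := by
    rw [ProbabilityTheory.cond, ProbabilityTheory.cond, measure_congr hF,
      Measure.restrict_congr_set hF]
  rw [h, cond_apply hF']
  congr 1
  exact measure_congr (((hF.inter (Filter.EventuallyEq.refl _ E)).symm).trans hD)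

namespace CTMC

variable {S C : Type*} [Fintype S] [DecidableEq S]

/-- The probability that the process in state `s` at time `T k` is in `A (k + i)` at time
`T (k + i + 1)` for all `i < n`, as a sum over the states at these times of products of transient
probabilities. -/
def visitProb (M : CTMC S C) (T : ℕ → ℝ≥0) (A : ℕ → Set S) : ℕ → ℕ → S → ℝ≥0∞
  | 0, _, _ => 1
  | n + 1, k, s =>
    ∑ s', M.transient s (T (k + 1) - T k) s' * (A k).indicator (M.visitProb T A n (k + 1)) s'

variable [MeasurableSpace S] [DiscreteMeasurableSpace S]

theorem pathFrom_forall_occupiesAt (M : CTMC S C) {T : ℕ → ℝ≥0} (hT : Monotone T) (A : ℕ → Set S)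
    (n k : ℕ) (s : S) :
    M.pathFrom s {π | ∀ i : Fin n, π.OccupiesAt (T (k + i + 1) - T k) (A (k + i))} =
      M.visitProb T A n k s := by
  induction n generalizing k s with
  | zero => simp [visitProb]
  | succ n ih =>
    have h : {π : Path S | ∀ i : Fin (n + 1), π.OccupiesAt (T (k + i + 1) - T k) (A (k + i))} =
        {π : Path S | π.OccupiesAt (T (k + 1) - T k) (A k) ∧ ∀ i : Fin n, π.OccupiesAt
          (T (k + 1) - T k + (T (k + 1 + i + 1) - T (k + 1))) (A (k + 1 + i))} := by
      ext π
      simp only [Set.mem_ofPred_eq, Fin.forall_fin_succ]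
      refine and_congr Iff.rfl (forall_congr' fun i => ?_)
      have h1 : T (k + 1) - T k + (T (k + 1 + i + 1) - T (k + 1)) = T (k + 1 + i + 1) - T k := by
        rw [add_comm]
        exact tsub_add_tsub_cancel (hT (by omega)) (hT (by omega))
      rw [h1, Fin.val_succ, show k + ((i : ℕ) + 1) = k + 1 + i by ring]
    rw [h, pathFrom_occupiesAt_and, visitProb]
    simp only [ih]

theorem condTransient_eq {d : ℕ} [NeZero d] (M : CTMC S C) (ρ : Evidence C d) (s : S) :
    M.condTransient ρ s = (M.visitProb ρ.obsTime (ρ.compatible M) d 0 M.init)⁻¹ *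
      M.visitProb ρ.obsTime (ρ.compatibleEnding M s) d 0 M.init := by
  have hae : ∀ᵐ π ∂M.pathFrom M.init, ∀ i : Fin d, π.OccupiesAt (ρ.time i) Set.univ :=
    ae_all_iff.2 fun i => M.ae_occupiesAt_univ _ _
  have ht : ∀ i : Fin d, ρ.obsTime (0 + i + 1) - ρ.obsTime 0 = ρ.time i := by
    intro i
    rw [zero_add, ρ.obsTime_succ, Evidence.obsTime, tsub_zero]
  rw [← M.pathFrom_forall_occupiesAt ρ.monotone_obsTime,
    ← M.pathFrom_forall_occupiesAt ρ.monotone_obsTime, condTransient, pathMeasure_eq_pathFrom]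
  simp only [ht]
  refine cond_apply_of_ae_eq ?_ ?_ ?_
  · rw [show {π : Path S | ∀ i : Fin d, π.OccupiesAt (ρ.time i) (ρ.compatible M (0 + i))} =
      ⋂ i : Fin d, {π : Path S | π.OccupiesAt (ρ.time i) (ρ.compatible M (0 + i))} by ext; simp]
    exact MeasurableSet.iInter fun i =>
      measurable_prodMk_left (x := ρ.time i) (Path.measurableSet_occupiesAt _)
  · filter_upwards [hae] with π hπ
    refine propext ?_
    change (∀ i, M.label (π.stateAt (ρ.time i)) = ρ.label i) ↔
      ∀ i : Fin d, π.OccupiesAt (ρ.time i) (ρ.compatible M (0 + i))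
    rw [← ρ.forall_mem_compatible M fun i => π.stateAt (ρ.time i)]
    exact forall_congr' fun i => (Path.occupiesAt_iff (hπ i) _).symm
  · filter_upwards [hae] with π hπ
    refine propext ?_
    change ((∀ i, M.label (π.stateAt (ρ.time i)) = ρ.label i) ∧
        π.stateAt (ρ.time (Evidence.lastIdx d)) = s) ↔
      ∀ i : Fin d, π.OccupiesAt (ρ.time i) (ρ.compatibleEnding M s (0 + i))
    rw [← ρ.forall_mem_compatibleEnding M s fun i => π.stateAt (ρ.time i)]
    exact forall_congr' fun i => (Path.occupiesAt_iff (hπ i) _).symm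

end CTMC

/-! ### Almost sure properties of Markov chains -/

namespace MarkovChain

variable {X : Type*} [MeasurableSpace X]

lemma ae_chainKernel_of_cons (κ : Kernel X X) [IsMarkovKernel κ] (x : X) {P : (ℕ → X) → Prop}
    (hP : MeasurableSet {ω | P ω})
    (h : ∀ᵐ y ∂κ x, ∀ᵐ ω ∂chainKernel κ y, P (consPath x ω)) : ∀ᵐ ω ∂chainKernel κ x, P ω := by
  have hx := measurable_consPath_right x
  have hP' : MeasurableSet {ω | P (consPath x ω)} := hx hP
  rw [chainKernel_eq_map_consPath, ae_map_iff hx.aemeasurable hP]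
  exact (Measure.ae_comp_iff hP').2 h

lemma ae_eval_zero (κ : Kernel X X) [IsMarkovKernel κ] [MeasurableSingletonClass X] (x : X) :
    ∀ᵐ ω ∂chainKernel κ x, ω 0 = x := by
  refine ae_chainKernel_of_cons κ x ?_ (Filter.Eventually.of_forall fun y =>
    Filter.Eventually.of_forall fun ω => rfl)
  have hm : Measurable fun ω : ℕ → X => ω 0 := by fun_prop
  exact hm (measurableSet_singleton x)

/-- A relation that almost surely holds for one step from every state almost surely holds for all
steps of the chain. -/
lemma ae_forall_step (κ : Kernel X X) [IsMarkovKernel κ] [MeasurableSingletonClass X]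
    {R : X → X → Prop} (hR : MeasurableSet {p : X × X | R p.1 p.2})
    (h : ∀ x, ∀ᵐ y ∂κ x, R x y) (x : X) :
    ∀ᵐ ω ∂chainKernel κ x, ∀ n, R (ω n) (ω (n + 1)) := by
  refine ae_all_iff.2 fun n => ?_
  have hm : ∀ n, MeasurableSet {ω : ℕ → X | R (ω n) (ω (n + 1))} := by
    intro n
    have hm : Measurable fun ω : ℕ → X => (ω n, ω (n + 1)) := by fun_prop
    exact hm hR
  induction n generalizing x with
  | zero =>
    refine ae_chainKernel_of_cons κ x (hm 0) ?_
    filter_upwards [h x] with y hy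
    filter_upwards [ae_eval_zero κ y] with ω hω
    change R x (ω 0)
    rwa [hω]
  | succ n ih =>
    exact ae_chainKernel_of_cons κ x (hm (n + 1)) (Filter.Eventually.of_forall fun y => ih y)

end MarkovChain

/-! ### The Markov chain that a consistent scheduler induces on the unfolding -/

namespace MDP

variable {Q A : Type*} [MeasurableSpace Q] [DiscreteMeasurableSpace Q]

/-- The one-step kernel of the Markov chain induced by a scheduler. -/
def inducedKernel (M : MDP Q A) (σ : M.Scheduler) : Kernel Q Q :=
  ⟨fun q => (M.inducedStep σ q).toMeasure, .of_discrete⟩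

instance (M : MDP Q A) (σ : M.Scheduler) : IsMarkovKernel (M.inducedKernel σ) :=
  ⟨fun q => inferInstanceAs (IsProbabilityMeasure (M.inducedStep σ q).toMeasure)⟩

lemma pathMeasure_eq_chainKernel (M : MDP Q A) (σ : M.Scheduler) :
    M.pathMeasure σ = MarkovChain.chainKernel (M.inducedKernel σ) M.init :=
  (MarkovChain.chainKernel_apply (M.inducedKernel σ) M.init).symm

lemma ae_inducedKernel (M : MDP Q A) (σ : M.Scheduler) (q : Q) {P : Q → Prop}
    (h : ∀ q' ∈ (M.inducedStep σ q).support, P q') : ∀ᵐ q' ∂M.inducedKernel σ q, P q' := by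
  rw [ae_iff]
  change (M.inducedStep σ q).toMeasure {q' | ¬P q'} = 0
  rw [PMF.toMeasure_apply_eq_zero_iff _ MeasurableSet.of_discrete]
  exact Set.disjoint_left.2 fun q' hq' hn => hn (h q' hq')

end MDP

namespace CTMC

variable {S C : Type*} [Fintype S] [DecidableEq S] {d : ℕ} [NeZero d] {M : CTMC S C}
  {Ω : ImpreciseEvidence C d} {σ : (M.unfold Ω.graph).Scheduler} {ρ : Evidence C d}

lemma act_eq_node (hσ : σ.Consistent ρ) {q : UnfoldState S Ω.graph} {k : ℕ} (hk : k ≤ d)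
    (hq : (q.time : TimePoint) = ρ.node k) : (σ.act q : TimePoint) = ρ.node (k + 1) := by
  obtain ⟨h1, h2, h3⟩ := hσ q
  cases k with
  | zero => exact (h1 hq).trans (ρ.node_succ (Evidence.firstIdx d)).symm
  | succ k =>
    have hq' := hq.trans (ρ.node_succ ⟨k, hk⟩)
    by_cases hkd : k + 1 < d
    · exact (h2 ⟨k, hk⟩ ⟨k + 1, hkd⟩ rfl hq').trans (ρ.node_succ ⟨k + 1, hkd⟩).symm
    · have hl : (⟨k, hk⟩ : Fin d) = Evidence.lastIdx d := by ext; simp only; omega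
      rw [hl] at hq'
      rw [h3 hq', ρ.node_of_gt (by omega)]

/-- Before the terminal node, one step of the induced chain goes to the next node of `ρ`. -/
lemma inducedStep_of_le (hρ : ρ ∈ Ω) (hσ : σ.Consistent ρ) {q : UnfoldState S Ω.graph} {k : ℕ}
    (hk : k ≤ d) (hq : (q.time : TimePoint) = ρ.node k) :
    (M.unfold Ω.graph).inducedStep σ q =
      (M.unfoldStep q.state (ρ.node k) (ρ.node (k + 1))).map fun s' => ⟨s', σ.act q⟩ := by
  have hne : ((M.unfold Ω.graph).enabled q).Nonempty := by
    have he : Ω.graph.Edge (ρ.node k) (ρ.node (k + 1)) := ⟨ρ, hρ, ρ.node_edge hk⟩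
    refine ⟨⟨_, (Ω.graph.edge_mem _ _ he).2⟩, ?_⟩
    change Ω.graph.Edge q.time _
    rwa [hq]
  rw [MDP.inducedStep, dif_pos hne, ← act_eq_node hσ hk hq, ← hq]
  rfl

lemma inducedStep_of_top {q : UnfoldState S Ω.graph} (hq : (q.time : TimePoint) = ⊤) :
    (M.unfold Ω.graph).inducedStep σ q = PMF.pure q := by
  rw [MDP.inducedStep, dif_neg]
  rintro ⟨t', ht'⟩
  have : (q.time : TimePoint) < t' := Ω.graph.edge_lt _ _ ht'
  rw [hq] at this
  exact not_top_lt this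

lemma ae_inducedKernel_node (hρ : ρ ∈ Ω) (hσ : σ.Consistent ρ) (q : UnfoldState S Ω.graph) :
    ∀ᵐ q' ∂(M.unfold Ω.graph).inducedKernel σ q,
      ∀ k, (q.time : TimePoint) = ρ.node k → (q'.time : TimePoint) = ρ.node (k + 1) ∧
        (d ≤ k → q'.state = q.state) := by
  refine MDP.ae_inducedKernel _ _ _ fun q' hq' k hk => ?_
  by_cases hkd : k ≤ d
  · rw [inducedStep_of_le hρ hσ hkd hk, PMF.support_map] at hq'
    obtain ⟨s', hs', rfl⟩ := hq'
    refine ⟨act_eq_node hσ hkd hk, fun hdk => ?_⟩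
    rw [ρ.node_of_gt (k := k + 1) (by omega)] at hs'
    have hstep : M.unfoldStep q.state (ρ.node k) ⊤ = PMF.pure q.state := by
      cases ρ.node k <;> rfl
    rw [hstep, PMF.support_pure] at hs'
    exact hs'
  · have htop := ρ.node_of_gt (not_le.1 hkd)
    rw [inducedStep_of_top (hk.trans htop), PMF.support_pure] at hq'
    obtain rfl : q' = q := hq'
    exact ⟨hk.trans (htop.trans (ρ.node_of_gt (by omega)).symm), fun _ => rfl⟩

/-- Under a scheduler consistent with `ρ`, almost every path runs through the nodes of `ρ` in
order and keeps its CTMC state from the last observation on. -/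
lemma ae_path_node (hρ : ρ ∈ Ω) (hσ : σ.Consistent ρ) :
    ∀ᵐ ξ ∂(M.unfold Ω.graph).pathMeasure σ, (∀ n, ((ξ n).time : TimePoint) = ρ.node n) ∧
      ∀ n, d ≤ n → (ξ n).state = (ξ d).state := by
  have hmeas : MeasurableSet {p : UnfoldState S Ω.graph × UnfoldState S Ω.graph |
      ∀ k, (p.1.time : TimePoint) = ρ.node k → (p.2.time : TimePoint) = ρ.node (k + 1) ∧
        (d ≤ k → p.2.state = p.1.state)} := by
    have h1 : ∀ P : UnfoldState S Ω.graph → Prop, MeasurableSet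
        {p : UnfoldState S Ω.graph × UnfoldState S Ω.graph | P p.1} :=
      fun P => measurable_fst (MeasurableSet.of_discrete (s := {q | P q}))
    have h2 : ∀ P : UnfoldState S Ω.graph → Prop, MeasurableSet
        {p : UnfoldState S Ω.graph × UnfoldState S Ω.graph | P p.2} :=
      fun P => measurable_snd (MeasurableSet.of_discrete (s := {q | P q}))
    -- Equality of the two states is a finite union of rectangles; the set of states of the
    -- unfolding may be uncountable, so that general relations need not be measurable.
    have h3 : MeasurableSet {p : UnfoldState S Ω.graph × UnfoldState S Ω.graph |
        p.2.state = p.1.state} := by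
      rw [show {p : UnfoldState S Ω.graph × UnfoldState S Ω.graph | p.2.state = p.1.state} =
        ⋃ s, {p | p.2.state = s} ∩ {p | p.1.state = s} by ext p; simp [eq_comm]]
      exact MeasurableSet.iUnion fun s => (h2 fun q => q.state = s).inter (h1 fun q => q.state = s)
    refine measurableSet_setOfPred.2 (Measurable.forall fun k => ?_)
    exact (measurableSet_setOfPred.1 (h1 fun q => (q.time : TimePoint) = ρ.node k)).imp
      ((measurableSet_setOfPred.1 (h2 fun q => (q.time : TimePoint) = ρ.node (k + 1))).and
        (measurable_const.imp (measurableSet_setOfPred.1 h3)))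
  rw [MDP.pathMeasure_eq_chainKernel]
  filter_upwards [MarkovChain.ae_eval_zero _ _, MarkovChain.ae_forall_step _ hmeas
    (ae_inducedKernel_node hρ hσ) _] with ξ h0 hstep
  have ht : ∀ n, ((ξ n).time : TimePoint) = ρ.node n := by
    intro n
    induction n with
    | zero => rw [h0]; rfl
    | succ n ih => exact (hstep n n ih).1
  refine ⟨ht, fun n hn => ?_⟩
  induction n, hn using Nat.le_induction with
  | base => rfl
  | succ n hn ih => rw [(hstep n n (ht n)).2 hn, ih]

omit [Fintype S] [DecidableEq S] in
lemma measurableSet_forall_state_mem {G : EvidenceGraph} (A : ℕ → Set S) (n k : ℕ) :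
    MeasurableSet {ξ : ℕ → UnfoldState S G | ∀ i : Fin n, (ξ (i + 1)).state ∈ A (k + i)} := by
  rw [show {ξ : ℕ → UnfoldState S G | ∀ i : Fin n, (ξ (i + 1)).state ∈ A (k + i)} =
    ⋂ i : Fin n, (fun ξ => ξ (i + 1)) ⁻¹' {q | q.state ∈ A (k + i)} by ext; simp]
  exact MeasurableSet.iInter fun i => measurable_pi_apply _ MeasurableSet.of_discrete

theorem chainKernel_forall_state_mem (hρ : ρ ∈ Ω) (hσ : σ.Consistent ρ) (A : ℕ → Set S) (n k : ℕ)
    (hnk : k + n ≤ d) (q : UnfoldState S Ω.graph) (hq : (q.time : TimePoint) = ρ.node k) :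
    MarkovChain.chainKernel ((M.unfold Ω.graph).inducedKernel σ) q
      {ξ | ∀ i : Fin n, (ξ (i + 1)).state ∈ A (k + i)} =
      M.visitProb ρ.obsTime A n k q.state := by
  induction n generalizing k q with
  | zero => simp [visitProb]
  | succ n ih =>
    have hm := measurableSet_forall_state_mem (G := Ω.graph) A (n + 1) k
    rw [MarkovChain.measure_chainKernel _ _ hm]
    change ∫⁻ y, _ ∂((M.unfold Ω.graph).inducedStep σ q).toMeasure = _
    have hstep : M.unfoldStep q.state (ρ.node k) (ρ.node (k + 1)) =
        M.transient q.state (ρ.obsTime (k + 1) - ρ.obsTime k) := by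
      rw [ρ.node_eq_obsTime (by omega), ρ.node_eq_obsTime (by omega)]
      rfl
    let _ : MeasurableSpace S := ⊤
    have : DiscreteMeasurableSpace S := ⟨fun _ => trivial⟩
    rw [inducedStep_of_le hρ hσ (by omega) hq, hstep, ← PMF.toMeasure_map _ _ .of_discrete,
      lintegral_map .of_discrete .of_discrete, lintegral_fintype, visitProb]
    refine Finset.sum_congr rfl fun s' _ => ?_
    rw [PMF.toMeasure_apply_singleton _ _ (MeasurableSet.singleton s'), mul_comm]
    congr 1
    have hq' := act_eq_node hσ (by omega) hq
    have hih := ih (k + 1) (by omega) ⟨s', σ.act q⟩ hq'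
    have hsplit : ∀ᵐ ω ∂MarkovChain.chainKernel ((M.unfold Ω.graph).inducedKernel σ)
        ⟨s', σ.act q⟩, (∀ i : Fin (n + 1), (MarkovChain.consPath q ω (i + 1)).state ∈ A (k + i)) ↔
        s' ∈ A k ∧ ∀ i : Fin n, (ω (i + 1)).state ∈ A (k + 1 + i) := by
      filter_upwards [MarkovChain.ae_eval_zero _ _] with ω hω
      rw [Fin.forall_fin_succ]
      refine and_congr ?_ (forall_congr' fun i => ?_)
      · change (ω 0).state ∈ A k ↔ _
        rw [hω]
      · change (ω (i + 1)).state ∈ A (k + (i + 1)) ↔ _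
        rw [show k + ((i : ℕ) + 1) = k + 1 + i by ring]
    by_cases hs : s' ∈ A k
    · rw [Set.indicator_of_mem hs, ← hih]
      refine measure_congr ?_
      filter_upwards [hsplit] with ω hω
      exact propext (hω.trans (and_iff_right hs))
    · rw [Set.indicator_of_notMem hs, measure_eq_zero_iff_ae_notMem]
      filter_upwards [hsplit] with ω hω
      exact fun h => hs (hω.1 h).1

theorem condReach_eq (hρ : ρ ∈ Ω) (hσ : σ.Consistent ρ) (s : S) :
    M.condReach σ ρ s = (M.visitProb ρ.obsTime (ρ.compatible M) d 0 M.init)⁻¹ *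
      M.visitProb ρ.obsTime (ρ.compatibleEnding M s) d 0 M.init := by
  have hae := ae_path_node (M := M) hρ hσ
  have hd := NeZero.pos d
  have hch : ∀ A : ℕ → Set S, (M.unfold Ω.graph).pathMeasure σ
      {ξ | ∀ i : Fin d, (ξ (i + 1)).state ∈ A (0 + i)} =
      M.visitProb ρ.obsTime A d 0 M.init := by
    intro A
    rw [MDP.pathMeasure_eq_chainKernel]
    exact chainKernel_forall_state_mem hρ hσ A d 0 (by omega) _ rfl
  have hsat : ∀ ξ : ℕ → UnfoldState S Ω.graph, (∀ n, ((ξ n).time : TimePoint) = ρ.node n) →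
      (UnfoldState.PathSatisfies M ξ ρ ↔ ∀ i : Fin d, M.label (ξ (i + 1)).state = ρ.label i) := by
    intro ξ hξ
    refine forall_congr' fun i => ⟨?_, fun h => ⟨i + 1, (hξ _).trans (ρ.node_succ i), h⟩⟩
    rintro ⟨n, hn, hl⟩
    have : (i : ℕ) + 1 = n := ρ.node_inj (by omega) (by rw [ρ.node_succ, ← hn, hξ])
    rwa [this]
  rw [← hch, ← hch, condReach]
  refine cond_apply_of_ae_eq (measurableSet_forall_state_mem _ d 0) ?_ ?_
  · filter_upwards [hae] with ξ hξ
    refine propext ?_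
    change UnfoldState.PathSatisfies M ξ ρ ↔ ∀ i : Fin d, (ξ (i + 1)).state ∈ _
    rw [ρ.forall_mem_compatible M fun i => (ξ (i + 1)).state, hsat ξ hξ.1]
  · filter_upwards [hae] with ξ hξ
    refine propext ?_
    change (UnfoldState.PathSatisfies M ξ ρ ∧ UnfoldState.Reaches ξ s) ↔
      ∀ i : Fin d, (ξ (i + 1)).state ∈ _
    rw [ρ.forall_mem_compatibleEnding M s fun i => (ξ (i + 1)).state, hsat ξ hξ.1]
    refine and_congr Iff.rfl ?_
    simp only [Nat.sub_add_cancel hd]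
    constructor
    · rintro ⟨n, hn, ht⟩
      have hdn : d < n := by
        by_contra hcon
        rw [hξ.1, ρ.node_eq_obsTime (not_lt.1 hcon)] at ht
        exact WithTop.coe_ne_top ht
      rw [← hξ.2 n hdn.le, hn]
    · exact fun h => ⟨d + 1, (hξ.2 _ (by omega)).trans h,
        (hξ.1 _).trans (ρ.node_of_gt (by omega))⟩

lemma exists_consistent (M : CTMC S C) (hρ : ρ ∈ Ω) :
    ∃ σ : (M.unfold Ω.graph).Scheduler, σ.Consistent ρ := by
  classical
  have hmem : ∀ k, k ≤ d → ρ.node (k + 1) ∈ Ω.graph.nodes := fun k hk =>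
    (Ω.graph.edge_mem _ _ ⟨ρ, hρ, ρ.node_edge hk⟩).2
  let f : UnfoldState S Ω.graph → Ω.graph.nodes := fun q =>
    if h : ∃ k, k ≤ d ∧ (q.time : TimePoint) = ρ.node k then
      ⟨ρ.node (h.choose + 1), hmem _ h.choose_spec.1⟩
    else if h' : ((M.unfold Ω.graph).enabled q).Nonempty then h'.choose
    else ⟨0, Ω.graph.zero_mem⟩
  have hf : ∀ q k, k ≤ d → (q.time : TimePoint) = ρ.node k →
      (f q : TimePoint) = ρ.node (k + 1) := by
    intro q k hk hq
    have h : ∃ k, k ≤ d ∧ (q.time : TimePoint) = ρ.node k := ⟨k, hk, hq⟩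
    have : h.choose = k := ρ.node_inj h.choose_spec.1 (h.choose_spec.2.symm.trans hq)
    simp only [f, dif_pos h, this]
  refine ⟨⟨f, fun q hq => ?_⟩, fun q => ⟨fun h => ?_, fun i j hij h => ?_, fun h => ?_⟩⟩
  · by_cases h : ∃ k, k ≤ d ∧ (q.time : TimePoint) = ρ.node k
    · obtain ⟨k, hk, hqk⟩ := h
      change Ω.graph.Edge q.time (f q)
      rw [hf q k hk hqk, hqk]
      exact ⟨ρ, hρ, ρ.node_edge hk⟩
    · simp only [f, dif_neg h, dif_pos hq]
      exact hq.choose_spec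
  · exact (hf q 0 (Nat.zero_le d) h).trans (ρ.node_succ (Evidence.firstIdx d))
  · have := hf q (i + 1) i.2 (h.trans (ρ.node_succ i).symm)
    rw [hij] at this
    exact this.trans (ρ.node_succ j)
  · have hd := NeZero.pos d
    have hl := h.trans (ρ.node_succ (Evidence.lastIdx d)).symm
    simp only [Nat.sub_add_cancel hd] at hl
    exact (hf q d le_rfl hl).trans (ρ.node_of_gt (by omega))

end CTMC

end

theorem theorem1 {S C : Type*} [Fintype S] [DecidableEq S] [MeasurableSpace S]
    [DiscreteMeasurableSpace S] {d : ℕ} [NeZero d] (M : CTMC S C) (w : S → ℝ≥0)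
    (Ω : ImpreciseEvidence C d) :
    (∀ ρ ∈ Ω, ∀ σ : (M.unfold Ω.graph).Scheduler, σ.Consistent ρ →
      ∀ s, M.condTransient ρ s = M.condReach σ ρ s) ∧
    M.weightedReach w Ω =
      ⨆ (σ : (M.unfold Ω.graph).Scheduler) (ρ : Evidence C d) (_ : ρ ∈ Ω ∧ σ.Consistent ρ),
        ∑ s, M.condReach σ ρ s * w s := by
  have hmain : ∀ ρ ∈ Ω, ∀ σ : (M.unfold Ω.graph).Scheduler, σ.Consistent ρ →
      ∀ s, M.condTransient ρ s = M.condReach σ ρ s := fun ρ hρ σ hσ s => by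
    rw [M.condTransient_eq, CTMC.condReach_eq hρ hσ]
  refine ⟨hmain, le_antisymm (iSup₂_le fun ρ hρ => ?_) ?_⟩
  · obtain ⟨σ, hσ⟩ := CTMC.exists_consistent M hρ
    simp only [hmain ρ hρ σ hσ]
    exact le_iSup_of_le σ (le_iSup₂_of_le ρ ⟨hρ, hσ⟩ le_rfl)
  · refine iSup_le fun σ => iSup₂_le fun ρ ⟨hρ, hσ⟩ => ?_
    simp only [← hmain ρ hρ σ hσ]
    exact le_iSup₂_of_le ρ hρ le_rfl
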